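/- Consider on a probability space the linear system $x_{k+1}=Ax_k+w_k$, $y_k=Cx_k+v_k$ ($k\ge 0$), with $x_k\in\mathbb R^n$, $y_k\in\mathbb R^m$, where $x_0\sim\mathcal N(0,\Sigma_0)$, $w_k\sim\mathcal N(0,Q)$, $v_k\sim\mathcal N(0,R)$ with $\Sigma_0,Q,R$ positive definite. Let $\zeta_k$ be uniformly distributed on $[0,1]$, and let $x_0$ and all the $w_k$, $v_k$, $\zeta_k$ be mutually independent. Let $Z\in\mathbb R^{m\times m}$ be symmetric positive definite. For decision variables $\gamma_k\in\{0,1\}$ write $\mathcal I_k=\{\gamma_0,\dots,\gamma_k,\gamma_0y_0,\dots,\gamma_ky_k\}$, $\mathcal I_{-1}=\emptyset$, and $$\hat x_k^-=\mathbb E[x_k\mid\mathcal I_{k-1}],\quad P_k^-=\mathbb E[(x_k-\hat x_k^-)(x_k-\hat x_k^-)'\mid\mathcal I_{k-1}],\quad \hat x_k=\mathbb E[x_k\mid\mathcal I_k],\quad P_k=\mathbb E[(x_k-\hat x_k)(x_k-\hat x_k)'\mid\mathcal I_k],$$ $$z_k=y_k-\mathbb E[y_k\mid\mathcal I_{k-1}].$$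 Suppose that the closed-loop stochastic event-triggered scheduler is used: $\gamma_k=0$ if $\zeta_k\le\exp(-\tfrac12 z_k'Zz_k)$, and $\gamma_k=1$ (that is, $y_k$ is transmitted) otherwise. Then, for every $k\ge0$, $x_k$ and $y_k$ are square-integrable (so that the quantities above are well defined), the conditional distribution of $x_k$ given $\mathcal I_{k-1}$ is almost surely the Gaussian law $\mathcal N(\hat x_k^-,P_k^-)$, the conditional distribution of $x_k$ given $\mathcal I_k$ is almost surely the Gaussian law $\mathcal N(\hat x_k,P_k)$, and almost surely the following recursion holds. Initial condition: $\hat x_0^-=0$, $P_0^-=\Sigma_0$. Time update ($k\ge1$): $\hat x_k^-=A\hat x_{k-1}$, $\;P_k^-=AP_{k-1}A'+Q$. Measurement update ($k\ge0$): $\hat x_k=\hat x_k^-+\gamma_kK_kz_k$, $\;P_k=P_k^--K_kCP_k^-$, where $K_k=P_k^-C'\left[CP_k^-C'+R+(1-\gamma_k)Z^{-1}\right]^{-1}$. -/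

import Mathlib

open MeasureTheory ProbabilityTheory
open scoped Matrix

namespace EventTriggered

noncomputable section

/-- The matrix-vector product, between Euclidean spaces. -/
def mulE {p q : ℕ} (M : Matrix (Fin p) (Fin q) ℝ) (u : EuclideanSpace ℝ (Fin q)) :
    EuclideanSpace ℝ (Fin p) :=
  WithLp.toLp 2 (M *ᵥ u.ofLp)

/-- The triggering function `ν(z) = exp (-(1/2) z' Z z)`. -/
def nu {m : ℕ} (Z : Matrix (Fin m) (Fin m) ℝ) (z : EuclideanSpace ℝ (Fin m)) : ℝ :=
  Real.exp (-(1 / 2) * (z.ofLp ⬝ᵥ Z *ᵥ z.ofLp))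

/-- The data available to the estimator strictly before time `k`, as one random variable:
`(γ_0, γ_0 y_0), …, (γ_{k-1}, γ_{k-1} y_{k-1})`. Thus `hist γ y k` is the information set
`I_{k-1}`, and `hist γ y (k + 1)` is `I_k`; for `k = 0` it is the empty tuple. -/
def hist {Ω : Type*} {m : ℕ} (γ : ℕ → Ω → ℝ) (y : ℕ → Ω → EuclideanSpace ℝ (Fin m)) (k : ℕ) :
    Ω → Fin k → ℝ × EuclideanSpace ℝ (Fin m) :=
  fun ω j => (γ j ω, γ j ω • y j ω)

/-- The σ-algebra generated by the data available strictly before time `k`. -/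
abbrev info {Ω : Type*} {m : ℕ} (γ : ℕ → Ω → ℝ) (y : ℕ → Ω → EuclideanSpace ℝ (Fin m)) (k : ℕ) :
    MeasurableSpace Ω :=
  MeasurableSpace.comap (hist γ y k) inferInstance

variable {Ω : Type*} [MeasurableSpace Ω]

/-- The innovation `z_k = y_k - ŷ_k^-`, where `ŷ_k^- = E[y_k | I_{k-1}]`. -/
def innovation {m : ℕ} (P : Measure Ω) (γ : ℕ → Ω → ℝ) (y : ℕ → Ω → EuclideanSpace ℝ (Fin m))
    (k : ℕ) (ω : Ω) : EuclideanSpace ℝ (Fin m) :=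
  y k ω - (P[y k | info γ y k]) ω

/-- The conditional second moment matrix `E[e e' | 𝓘]` of the error `e = X - E[X | 𝓘]`. -/
def condCov {n : ℕ} (P : Measure Ω) (𝓘 : MeasurableSpace Ω) (X : Ω → EuclideanSpace ℝ (Fin n))
    (ω : Ω) : Matrix (Fin n) (Fin n) ℝ :=
  Matrix.of fun i j =>
    (P[fun ω' => (X ω' - (P[X | 𝓘]) ω') i * (X ω' - (P[X | 𝓘]) ω') j | 𝓘]) ω

/-- The a priori estimate `E[x_k | I_{k-1}]`. -/
def priorMean {n m : ℕ} (P : Measure Ω) (γ : ℕ → Ω → ℝ) (y : ℕ → Ω → EuclideanSpace ℝ (Fin m))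
    (x : ℕ → Ω → EuclideanSpace ℝ (Fin n)) (k : ℕ) : Ω → EuclideanSpace ℝ (Fin n) :=
  P[x k | info γ y k]

/-- The a posteriori estimate `E[x_k | I_k]`. -/
def postMean {n m : ℕ} (P : Measure Ω) (γ : ℕ → Ω → ℝ) (y : ℕ → Ω → EuclideanSpace ℝ (Fin m))
    (x : ℕ → Ω → EuclideanSpace ℝ (Fin n)) (k : ℕ) : Ω → EuclideanSpace ℝ (Fin n) :=
  P[x k | info γ y (k + 1)]

/-- The a priori error covariance `P_k^-`. -/
def priorCov {n m : ℕ} (P : Measure Ω) (γ : ℕ → Ω → ℝ) (y : ℕ → Ω → EuclideanSpace ℝ (Fin m))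
    (x : ℕ → Ω → EuclideanSpace ℝ (Fin n)) (k : ℕ) : Ω → Matrix (Fin n) (Fin n) ℝ :=
  condCov P (info γ y k) (x k)

/-- The a posteriori error covariance `P_k`. -/
def postCov {n m : ℕ} (P : Measure Ω) (γ : ℕ → Ω → ℝ) (y : ℕ → Ω → EuclideanSpace ℝ (Fin m))
    (x : ℕ → Ω → EuclideanSpace ℝ (Fin n)) (k : ℕ) : Ω → Matrix (Fin n) (Fin n) ℝ :=
  condCov P (info γ y (k + 1)) (x k)

/-- The gain `Π C' [C Π C' + R + (1 - g) Z⁻¹]⁻¹` for prior covariance `Π` and decision `g`. -/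
def gain {n m : ℕ} (C : Matrix (Fin m) (Fin n) ℝ) (R Z : Matrix (Fin m) (Fin m) ℝ)
    (Pi : Matrix (Fin n) (Fin n) ℝ) (g : ℝ) : Matrix (Fin n) (Fin m) ℝ :=
  Pi * Cᵀ * (C * Pi * Cᵀ + R + (1 - g) • Z⁻¹)⁻¹

/-- The conditional distribution of `X` given the random variable `H` is almost surely the
Gaussian law with (random) mean `μ` and (random) covariance matrix `S`. -/
def IsCondGaussian {n : ℕ} {β : Type*} [MeasurableSpace β] (P : Measure Ω) [IsFiniteMeasure P]
    (X : Ω → EuclideanSpace ℝ (Fin n)) (H : Ω → β)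
    (μ : Ω → EuclideanSpace ℝ (Fin n)) (S : Ω → Matrix (Fin n) (Fin n) ℝ) : Prop :=
  ∀ᵐ ω ∂P, (S ω).PosSemidef ∧ condDistrib X H P (H ω) = multivariateGaussian (μ ω) (S ω)

/-- The linear Gaussian system `x_{k+1} = A x_k + w_k`, `y_k = C x_k + v_k`, observed through the
closed-loop stochastic event-triggered scheduler with parameter `Z`. -/
structure IsClosedLoopSystem {n m : ℕ} (P : Measure Ω)
    (A : Matrix (Fin n) (Fin n) ℝ) (C : Matrix (Fin m) (Fin n) ℝ)
    (Q S₀ : Matrix (Fin n) (Fin n) ℝ) (R Z : Matrix (Fin m) (Fin m) ℝ)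
    (x w : ℕ → Ω → EuclideanSpace ℝ (Fin n)) (y v : ℕ → Ω → EuclideanSpace ℝ (Fin m))
    (ζ γ : ℕ → Ω → ℝ) : Prop where
  measurable_init : Measurable (x 0)
  measurable_w : ∀ k, Measurable (w k)
  measurable_v : ∀ k, Measurable (v k)
  measurable_ζ : ∀ k, Measurable (ζ k)
  measurable_γ : ∀ k, Measurable (γ k)
  /-- `x_0 ∼ N(0, S₀)` -/
  law_init : P.map (x 0) = multivariateGaussian 0 S₀
  /-- `w_k ∼ N(0, Q)` -/
  law_w : ∀ k, P.map (w k) = multivariateGaussian 0 Q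
  /-- `v_k ∼ N(0, R)` -/
  law_v : ∀ k, P.map (v k) = multivariateGaussian 0 R
  /-- `ζ_k` is uniformly distributed on `[0, 1]` -/
  law_ζ : ∀ k, pdf.IsUniform (ζ k) (Set.Icc 0 1) P
  /-- `x_0` and all the `w_k`, `v_k`, `ζ_k` are mutually independent. -/
  indep : iIndep (Sum.elim (fun _ : Unit => MeasurableSpace.comap (x 0) inferInstance)
    (Sum.elim (fun k : ℕ => MeasurableSpace.comap (w k) inferInstance)
      (Sum.elim (fun k : ℕ => MeasurableSpace.comap (v k) inferInstance)
        (fun k : ℕ => MeasurableSpace.comap (ζ k) inferInstance)))) P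
  state_eq : ∀ k ω, x (k + 1) ω = mulE A (x k ω) + w k ω
  output_eq : ∀ k ω, y k ω = mulE C (x k ω) + v k ω
  /-- The sensor transmits iff `ζ_k > ν(z_k)`. -/
  trigger : ∀ k, ∀ᵐ ω ∂P, γ k ω = if ζ k ω ≤ nu Z (innovation P γ y k ω) then 0 else 1

end

end EventTriggered

/-!
At every time the conditional law of the state given the data is Gaussian, with a mean that is a
measurable function of the data and a covariance that only depends on the past decisions. This is
proved by induction on time in the form of a disintegration (`GaussianGiven`): expectations of
functions of the data `H` and the state `X` are computed by integrating the state against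
`N(μ(H), S(H))`. Conditional means, conditional covariances and the regular conditional
distribution are then read off from the disintegration, and each step of the induction exhibits the
new `μ` and `S`, which is the recursion.

The time update adds an independent Gaussian noise (`GaussianGiven.time_update`). For the
measurement update (`GaussianGiven.measurement_update`), fix the old data, hence a prior
`N(μ, S)`. The innovation `z = y - C μ` has covariance `W = C S C' + R`, and the residual
`x - μ - K z`, with `K = S C' W⁻¹`, is uncorrelated with `z`, hence independent of it
(`lintegral_innovation_state`). If `y` is transmitted, the state is therefore
`N(μ + K z, S - K C S)`, since the decision is a function of `z` and of an independent uniform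
variable. If nothing is transmitted, the law of `z` is weighted by the probability
`ν(z) = exp (-z' Z z / 2)` of that event, and because `ν` is itself a Gaussian weight, the result
is again a centred Gaussian law, of covariance `(W⁻¹ + Z)⁻¹`
(`lintegral_nu_mul_multivariateGaussian`). Adding the independent residual gives `N(μ, S')` with
`S' = K (W⁻¹ + Z)⁻¹ K' + S - K C S`, and the matrix inversion lemma turns this into the
covariance after a measurement with noise covariance `R + Z⁻¹` (`kalmanCov_add_inv`).

Both updates need the independence of the new noises from the data. The prediction
`E[y_k | I_{k-1}]` in the trigger is a function of the data, so by induction the decisions are, up to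
null sets, functions of the noises that have already occurred (`exists_γ_version`). This prediction
equals `C x̂_k^-` (`condExp_y`), which identifies the `z_k` of the trigger with the innovation above.
-/

namespace EventTriggered

open scoped RealInnerProductSpace ENNReal MatrixOrder

/-! ### Linear maps between Euclidean spaces -/

section Linear

variable {p q : ℕ}

/-- `mulE M` as a continuous linear map. -/
noncomputable def mulCLM (M : Matrix (Fin p) (Fin q) ℝ) :
    EuclideanSpace ℝ (Fin q) →L[ℝ] EuclideanSpace ℝ (Fin p) :=
  LinearMap.toContinuousLinearMap (Matrix.toLpLin 2 2 M)

lemma measurable_mulE (M : Matrix (Fin p) (Fin q) ℝ) : Measurable (mulE M) :=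
  (mulCLM M).continuous.measurable

lemma mulE_sub (M : Matrix (Fin p) (Fin q) ℝ) (u v : EuclideanSpace ℝ (Fin q)) :
    mulE M (u - v) = mulE M u - mulE M v := (mulCLM M).map_sub u v

lemma mulE_add (M : Matrix (Fin p) (Fin q) ℝ) (u v : EuclideanSpace ℝ (Fin q)) :
    mulE M (u + v) = mulE M u + mulE M v := (mulCLM M).map_add u v

@[simp]
lemma mulE_zero_right (M : Matrix (Fin p) (Fin q) ℝ) : mulE M 0 = 0 := (mulCLM M).map_zero

@[simp]
lemma mulE_one (u : EuclideanSpace ℝ (Fin p)) : mulE 1 u = u := by simp [mulE]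

lemma inner_mulE_left (M : Matrix (Fin p) (Fin q) ℝ) (u : EuclideanSpace ℝ (Fin q))
    (t : EuclideanSpace ℝ (Fin p)) : ⟪mulE M u, t⟫ = ⟪u, mulE Mᵀ t⟫ := by
  simp only [mulE, EuclideanSpace.inner_eq_star_dotProduct, star_trivial]
  rw [Matrix.dotProduct_mulVec, ← Matrix.mulVec_transpose]

end Linear

/-! ### Linear images of independent Gaussian vectors -/

section Gaussian

variable {n m p q : ℕ}

lemma charFun_map_pair {μ : Measure (EuclideanSpace ℝ (Fin n))}
    {ν : Measure (EuclideanSpace ℝ (Fin m))} [IsProbabilityMeasure μ] [IsProbabilityMeasure ν]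
    (A₁ : Matrix (Fin p) (Fin n) ℝ) (B₁ : Matrix (Fin p) (Fin m) ℝ)
    (A₂ : Matrix (Fin q) (Fin n) ℝ) (B₂ : Matrix (Fin q) (Fin m) ℝ)
    (t : WithLp 2 (EuclideanSpace ℝ (Fin p) × EuclideanSpace ℝ (Fin q))) :
    charFun (((μ.prod ν).map
        (fun w ↦ (mulE A₁ w.1 + mulE B₁ w.2, mulE A₂ w.1 + mulE B₂ w.2))).map (WithLp.toLp 2)) t =
      charFun μ (mulE A₁ᵀ t.ofLp.1 + mulE A₂ᵀ t.ofLp.2) *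
        charFun ν (mulE B₁ᵀ t.ofLp.1 + mulE B₂ᵀ t.ofLp.2) := by
  have hA₁ := measurable_mulE A₁
  have hA₂ := measurable_mulE A₂
  have hB₁ := measurable_mulE B₁
  have hB₂ := measurable_mulE B₂
  rw [Measure.map_map (by fun_prop) (by fun_prop)]
  simp only [charFun_apply]
  rw [← integral_prod_mul, integral_map (by fun_prop) (by fun_prop)]
  refine integral_congr_ae (.of_forall fun w ↦ ?_)
  simp only [Function.comp_apply, WithLp.prod_inner_apply, inner_add_left, inner_add_right,
    inner_mulE_left, ← Complex.exp_add]
  congr 1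
  push_cast
  ring

lemma bilin_mulE_transpose (A : Matrix (Fin p) (Fin n) ℝ) (B : Matrix (Fin q) (Fin n) ℝ)
    (S : Matrix (Fin n) (Fin n) ℝ) (s : EuclideanSpace ℝ (Fin p)) (t : EuclideanSpace ℝ (Fin q)) :
    (mulE Aᵀ s).ofLp ⬝ᵥ S *ᵥ (mulE Bᵀ t).ofLp = s.ofLp ⬝ᵥ (A * S * Bᵀ) *ᵥ t.ofLp := by
  simp only [mulE, ← Matrix.mulVec_mulVec]
  rw [Matrix.mulVec_transpose, ← Matrix.dotProduct_mulVec]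

/-- Two linear combinations of independent centred Gaussian vectors are independent Gaussian
vectors as soon as their cross-covariance vanishes. -/
lemma map_pair_multivariateGaussian {S : Matrix (Fin n) (Fin n) ℝ} {R : Matrix (Fin m) (Fin m) ℝ}
    (hS : S.PosSemidef) (hR : R.PosSemidef)
    (A₁ : Matrix (Fin p) (Fin n) ℝ) (B₁ : Matrix (Fin p) (Fin m) ℝ)
    (A₂ : Matrix (Fin q) (Fin n) ℝ) (B₂ : Matrix (Fin q) (Fin m) ℝ)
    (h₁₂ : A₁ * S * A₂ᵀ + B₁ * R * B₂ᵀ = 0) :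
    ((multivariateGaussian 0 S).prod (multivariateGaussian 0 R)).map
        (fun w ↦ (mulE A₁ w.1 + mulE B₁ w.2, mulE A₂ w.1 + mulE B₂ w.2)) =
      (multivariateGaussian 0 (A₁ * S * A₁ᵀ + B₁ * R * B₁ᵀ)).prod
        (multivariateGaussian 0 (A₂ * S * A₂ᵀ + B₂ * R * B₂ᵀ)) := by
  have h₂₁ : A₂ * S * A₁ᵀ + B₂ * R * B₁ᵀ = 0 := by
    have h := congrArg Matrix.transpose h₁₂
    have hSt : Sᵀ = S := hS.1
    have hRt : Rᵀ = R := hR.1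
    simpa [Matrix.transpose_mul, hSt, hRt, Matrix.mul_assoc] using h
  have h1 : (A₁ * S * A₁ᵀ + B₁ * R * B₁ᵀ).PosSemidef := by
    simpa using (hS.mul_mul_conjTranspose_same A₁).add (hR.mul_mul_conjTranspose_same B₁)
  have h2 : (A₂ * S * A₂ᵀ + B₂ * R * B₂ᵀ).PosSemidef := by
    simpa using (hS.mul_mul_conjTranspose_same A₂).add (hR.mul_mul_conjTranspose_same B₂)
  have hm : Measurable fun w : EuclideanSpace ℝ (Fin n) × EuclideanSpace ℝ (Fin m) ↦
      (mulE A₁ w.1 + mulE B₁ w.2, mulE A₂ w.1 + mulE B₂ w.2) := by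
    have hA₁ := measurable_mulE A₁
    have hA₂ := measurable_mulE A₂
    have hB₁ := measurable_mulE B₁
    have hB₂ := measurable_mulE B₂
    fun_prop
  have := Measure.isProbabilityMeasure_map
    (μ := (multivariateGaussian 0 S).prod (multivariateGaussian 0 R)) hm.aemeasurable
  rw [← charFun_eq_prod_iff]
  intro t
  rw [charFun_map_pair, charFun_multivariateGaussian hS, charFun_multivariateGaussian hR,
    charFun_multivariateGaussian h1, charFun_multivariateGaussian h2, ← Complex.exp_add,
    ← Complex.exp_add]
  congr 1
  have e₁₂ := congrArg (fun M ↦ t.ofLp.1.ofLp ⬝ᵥ M *ᵥ t.ofLp.2.ofLp) h₁₂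
  have e₂₁ := congrArg (fun M ↦ t.ofLp.2.ofLp ⬝ᵥ M *ᵥ t.ofLp.1.ofLp) h₂₁
  simp only [Matrix.add_mulVec, dotProduct_add, Matrix.zero_mulVec, dotProduct_zero] at e₁₂ e₂₁
  simp only [WithLp.ofLp_add, Matrix.mulVec_add, add_dotProduct, dotProduct_add,
    bilin_mulE_transpose, Matrix.add_mulVec, inner_zero_right]
  have e₁₂' := congrArg Complex.ofReal e₁₂
  have e₂₁' := congrArg Complex.ofReal e₂₁
  push_cast at e₁₂' e₂₁' ⊢
  linear_combination (-1 / 2 : ℂ) * e₁₂' - (1 / 2 : ℂ) * e₂₁'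

lemma map_const_add_multivariateGaussian (a b : EuclideanSpace ℝ (Fin n))
    (S : Matrix (Fin n) (Fin n) ℝ) :
    (multivariateGaussian b S).map (fun u ↦ a + u) = multivariateGaussian (a + b) S := by
  rw [multivariateGaussian, multivariateGaussian, Measure.map_map (by fun_prop) (by fun_prop)]
  simp [Function.comp_def, add_assoc]

lemma lintegral_multivariateGaussian_shift (a b : EuclideanSpace ℝ (Fin n))
    (S : Matrix (Fin n) (Fin n) ℝ) {f : EuclideanSpace ℝ (Fin n) → ℝ≥0∞} (hf : Measurable f) :
    ∫⁻ u, f u ∂multivariateGaussian (a + b) S = ∫⁻ u, f (a + u) ∂multivariateGaussian b S := by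
  rw [← map_const_add_multivariateGaussian, lintegral_map hf (by fun_prop)]

/-- The law of `A x + v` for independent Gaussian vectors `x` and `v`. -/
lemma lintegral_multivariateGaussian_linear {S : Matrix (Fin n) (Fin n) ℝ}
    {R : Matrix (Fin m) (Fin m) ℝ} (hS : S.PosSemidef) (hR : R.PosSemidef)
    (A : Matrix (Fin m) (Fin n) ℝ) (a : EuclideanSpace ℝ (Fin n)) (b : EuclideanSpace ℝ (Fin m))
    {f : EuclideanSpace ℝ (Fin m) → ℝ≥0∞} (hf : Measurable f) :
    ∫⁻ u, ∫⁻ v, f (mulE A u + v) ∂multivariateGaussian b R ∂multivariateGaussian a S =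
      ∫⁻ x, f x ∂multivariateGaussian (mulE A a + b) (A * S * Aᵀ + R) := by
  have hA := measurable_mulE A
  -- The second component is taken in dimension zero and discarded.
  have key := map_pair_multivariateGaussian hS hR A 1 (0 : Matrix (Fin 0) (Fin n) ℝ) 0 (by simp)
  have key' := congrArg (Measure.map Prod.fst) key
  rw [Measure.map_map (by fun_prop)
      (by simp only [mulE_one]; exact (by fun_prop : Measurable _).prodMk
            ((measurable_mulE _).comp measurable_fst |>.add
              ((measurable_mulE _).comp measurable_snd))), Measure.map_fst_prod] at key'
  simp only [Function.comp_def, mulE_one, Matrix.one_mul, Matrix.transpose_one, Matrix.mul_one,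
    measure_univ, one_smul] at key'
  rw [← add_zero (mulE A a + b), lintegral_multivariateGaussian_shift _ _ _ hf, ← key',
    lintegral_map (by fun_prop) (by fun_prop), lintegral_prod _ (by fun_prop)]
  conv_lhs => rw [← add_zero a, ← add_zero b]
  rw [lintegral_multivariateGaussian_shift _ _ _ ?_]
  · refine lintegral_congr fun u ↦ ?_
    rw [lintegral_multivariateGaussian_shift _ _ _ (by fun_prop)]
    refine lintegral_congr fun v ↦ ?_
    rw [mulE_add]
    congr 1
    abel
  · exact Measurable.lintegral_prod_right (by fun_prop)

/-! ### The Gaussian density and exponential tilting -/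

/-- The Gaussian weight `exp (-‖z‖² / 2)` is a multiple of the standard Gaussian density; this is
read off from the Fourier transform of the weight. -/
lemma exists_withDensity_eq_stdGaussian :
    ∃ c : ℝ≥0∞, c ≠ 0 ∧ c ≠ ∞ ∧
      (volume : Measure (EuclideanSpace ℝ (Fin m))).withDensity
          (fun z ↦ ENNReal.ofReal (Real.exp (-(1 / 2) * ‖z‖ ^ 2))) =
        c • stdGaussian (EuclideanSpace ℝ (Fin m)) := by
  set d : ℝ := (Real.pi / (1 / 2)) ^ (Module.finrank ℝ (EuclideanSpace ℝ (Fin m)) / 2 : ℝ) with hd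
  have hd0 : 0 < d := by positivity
  have hint : ∫ z : EuclideanSpace ℝ (Fin m), Real.exp (-(1 / 2) * ‖z‖ ^ 2) = d :=
    GaussianFourier.integral_rexp_neg_mul_sq_norm (by norm_num)
  have hi : Integrable fun z : EuclideanSpace ℝ (Fin m) ↦ Real.exp (-(1 / 2) * ‖z‖ ^ 2) :=
    .of_integral_ne_zero (by rw [hint]; exact hd0.ne')
  refine ⟨ENNReal.ofReal d, by simpa using hd0, ENNReal.ofReal_ne_top, ?_⟩
  have := isFiniteMeasure_withDensity_ofReal hi.2
  have : IsFiniteMeasure (ENNReal.ofReal d • stdGaussian (EuclideanSpace ℝ (Fin m))) :=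
    Measure.smul_finite _ ENNReal.ofReal_ne_top
  refine Measure.ext_of_charFun (funext fun t ↦ ?_)
  have hdc : (d : ℂ) = (Real.pi / (1 / 2 : ℂ)) ^
      (Module.finrank ℝ (EuclideanSpace ℝ (Fin m)) / 2 : ℂ) := by
    rw [hd, Complex.ofReal_cpow (by positivity)]
    push_cast
    rfl
  have hL := GaussianFourier.integral_cexp_neg_mul_sq_norm_add (b := 1 / 2) (by norm_num)
    Complex.I t
  rw [← hdc] at hL
  rw [charFun_apply, charFun_apply, integral_smul_measure,
    ← charFun_apply (μ := stdGaussian (EuclideanSpace ℝ (Fin m))), charFun_stdGaussian,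
    integral_withDensity_eq_integral_toReal_smul (by fun_prop) (by simp)]
  simp_rw [ENNReal.toReal_ofReal (Real.exp_nonneg _)]
  rw [ENNReal.toReal_ofReal hd0.le, Complex.real_smul]
  convert hL using 1
  · refine integral_congr_ae (.of_forall fun z ↦ ?_)
    simp only [Complex.real_smul]
    rw [Complex.ofReal_exp, ← Complex.exp_add, real_inner_comm]
    congr 1
    push_cast
    ring
  · congr 2
    rw [Complex.I_sq]
    ring

lemma measurable_nu (Z : Matrix (Fin m) (Fin m) ℝ) : Measurable (nu Z) := by
  unfold nu
  simp only [dotProduct, Matrix.mulVec]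
  fun_prop

/-- Up to normalization, `N(0, S)` has density `exp (-z' S⁻¹ z / 2)`. -/
lemma exists_lintegral_multivariateGaussian {S : Matrix (Fin m) (Fin m) ℝ} (hS : S.PosDef) :
    ∃ c : ℝ≥0∞, c ≠ 0 ∧ c ≠ ∞ ∧ ∀ f : EuclideanSpace ℝ (Fin m) → ℝ≥0∞, Measurable f →
      ∫⁻ z, ENNReal.ofReal (nu S⁻¹ z) * f z = c * ∫⁻ z, f z ∂multivariateGaussian 0 S := by
  obtain ⟨c, hc0, hc, h⟩ := exists_withDensity_eq_stdGaussian (m := m)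
  -- `N(0, S)` is the image of the standard Gaussian law under the symmetric square root of `S`.
  set L : Matrix (Fin m) (Fin m) ℝ := CFC.sqrt S with hLdef
  have hLL : L * L = S := CFC.sqrt_mul_sqrt_self _ hS.posSemidef.nonneg
  have hLt : Lᵀ = L := (CFC.sqrt_nonneg S).isSelfAdjoint
  have hdet : L.det ≠ 0 := by
    intro h0
    have := congrArg Matrix.det hLL
    rw [Matrix.det_mul, h0, mul_zero] at this
    exact hS.det_pos.ne this
  have hunit : IsUnit L.det := isUnit_iff_ne_zero.2 hdet
  have hquad (u : EuclideanSpace ℝ (Fin m)) :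
      nu S⁻¹ (mulE L u) = Real.exp (-(1 / 2) * ‖u‖ ^ 2) := by
    have h1 : L * S⁻¹ * L = 1 := by
      rw [← hLL, Matrix.mul_inv_rev, ← Matrix.mul_assoc, Matrix.mul_nonsing_inv _ hunit,
        Matrix.one_mul, Matrix.nonsing_inv_mul _ hunit]
    have h2 := bilin_mulE_transpose L L S⁻¹ u u
    rw [hLt, h1, Matrix.one_mulVec] at h2
    rw [nu, h2, EuclideanSpace.real_norm_sq_eq]
    simp [dotProduct, sq]
  set T : EuclideanSpace ℝ (Fin m) →ₗ[ℝ] EuclideanSpace ℝ (Fin m) := Matrix.toLpLin 2 2 L with hT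
  have hTdet : LinearMap.det T ≠ 0 := by
    have : LinearMap.det T = L.det := by
      rw [hT]; simp
    rwa [this]
  have hmap := Measure.map_linearMap_addHaar_eq_smul_addHaar
    (volume : Measure (EuclideanSpace ℝ (Fin m))) hTdet
  set k : ℝ≥0∞ := ENNReal.ofReal |(LinearMap.det T)⁻¹| with hk
  have hk0 : k ≠ 0 := by simpa [hk] using hTdet
  have hkt : k ≠ ∞ := ENNReal.ofReal_ne_top
  have hTm : Measurable T := measurable_mulE L
  have hnu := measurable_nu S⁻¹
  refine ⟨k⁻¹ * c, by simp [hc0, hkt], by finiteness, fun f hf ↦ ?_⟩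
  have e1 : ∫⁻ z, ENNReal.ofReal (nu S⁻¹ z) * f z ∂(k • volume) =
      c * ∫⁻ z, f z ∂multivariateGaussian 0 S := by
    rw [← hmap, lintegral_map (by fun_prop) hTm]
    have : ∀ u, ENNReal.ofReal (nu S⁻¹ (T u)) * f (T u) =
        ENNReal.ofReal (Real.exp (-(1 / 2) * ‖u‖ ^ 2)) * f (mulE L u) := fun u ↦ by
      rw [← hquad]; rfl
    simp_rw [this]
    have hLm := measurable_mulE L
    have hdens := lintegral_withDensity_eq_lintegral_mul volume
      (f := fun z : EuclideanSpace ℝ (Fin m) ↦ ENNReal.ofReal (Real.exp (-(1 / 2) * ‖z‖ ^ 2)))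
      (by fun_prop) (hf.comp hLm)
    simp only [Pi.mul_apply, Function.comp_apply] at hdens
    rw [← hdens, h, lintegral_smul_measure, smul_eq_mul, multivariateGaussian,
      lintegral_map hf (by fun_prop)]
    simp only [zero_add]
    rfl
  rw [lintegral_smul_measure, smul_eq_mul] at e1
  rw [mul_assoc, ← e1, ← mul_assoc, ENNReal.inv_mul_cancel hk0 hkt, one_mul]

lemma nu_nonneg (Z : Matrix (Fin m) (Fin m) ℝ) (z : EuclideanSpace ℝ (Fin m)) : 0 ≤ nu Z z :=
  Real.exp_nonneg _

lemma nu_add (Z W : Matrix (Fin m) (Fin m) ℝ) (z : EuclideanSpace ℝ (Fin m)) :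
    nu (Z + W) z = nu Z z * nu W z := by
  simp only [nu, Matrix.add_mulVec, dotProduct_add, mul_add, Real.exp_add]

/-- Weighting a centred Gaussian law with precision `W⁻¹` by `ν` gives a multiple of the centred
Gaussian law with precision `W⁻¹ + Z`. -/
lemma lintegral_nu_mul_multivariateGaussian {W Z : Matrix (Fin m) (Fin m) ℝ} (hW : W.PosDef)
    (hZ : Z.PosDef) {f : EuclideanSpace ℝ (Fin m) → ℝ≥0∞} (hf : Measurable f) :
    ∫⁻ z, ENNReal.ofReal (nu Z z) * f z ∂multivariateGaussian 0 W =
      (∫⁻ z, ENNReal.ofReal (nu Z z) ∂multivariateGaussian 0 W) *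
        ∫⁻ z, f z ∂multivariateGaussian 0 (W⁻¹ + Z)⁻¹ := by
  have hWZ : (W⁻¹ + Z).PosDef := hW.inv.add hZ
  obtain ⟨c, hc0, hc, h⟩ := exists_lintegral_multivariateGaussian hW
  obtain ⟨k, hk0, hk, h'⟩ := exists_lintegral_multivariateGaussian hWZ.inv
  rw [Matrix.nonsing_inv_nonsing_inv _ ((Matrix.isUnit_iff_isUnit_det _).1 hWZ.isUnit)] at h'
  have hZm := measurable_nu Z
  have key : ∀ g : EuclideanSpace ℝ (Fin m) → ℝ≥0∞, Measurable g →
      c * ∫⁻ z, ENNReal.ofReal (nu Z z) * g z ∂multivariateGaussian 0 W =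
        k * ∫⁻ z, g z ∂multivariateGaussian 0 (W⁻¹ + Z)⁻¹ := by
    intro g hg
    rw [← h _ (by fun_prop), ← h' g hg]
    refine lintegral_congr fun z ↦ ?_
    rw [nu_add, ENNReal.ofReal_mul (nu_nonneg _ _), mul_assoc]
  -- The constant is identified by testing against `1`.
  have k1 := key 1 measurable_one
  simp only [Pi.one_apply, mul_one, lintegral_const, measure_univ] at k1
  have k2 := key f hf
  rw [← k1, mul_assoc] at k2
  exact (ENNReal.mul_right_inj hc0 hc).1 k2

end Gaussian

/-! ### The algebra of the measurement update -/

section Kalman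

variable {n m : ℕ}

/-- The Kalman gain `S C' (C S C' + R)⁻¹` for prior covariance `S` and noise covariance `R`. -/
noncomputable def kalmanGain (C : Matrix (Fin m) (Fin n) ℝ) (R : Matrix (Fin m) (Fin m) ℝ)
    (S : Matrix (Fin n) (Fin n) ℝ) : Matrix (Fin n) (Fin m) ℝ :=
  S * Cᵀ * (C * S * Cᵀ + R)⁻¹

/-- The posterior covariance `S - K C S`, where `K` is the Kalman gain. -/
noncomputable def kalmanCov (C : Matrix (Fin m) (Fin n) ℝ) (R : Matrix (Fin m) (Fin m) ℝ)
    (S : Matrix (Fin n) (Fin n) ℝ) : Matrix (Fin n) (Fin n) ℝ :=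
  S - kalmanGain C R S * C * S

lemma gain_eq_kalmanGain (C : Matrix (Fin m) (Fin n) ℝ) (R Z : Matrix (Fin m) (Fin m) ℝ)
    (S : Matrix (Fin n) (Fin n) ℝ) (g : ℝ) :
    gain C R Z S g = kalmanGain C (R + (1 - g) • Z⁻¹) S := by
  rw [gain, kalmanGain, add_assoc]

variable {C : Matrix (Fin m) (Fin n) ℝ} {R Z : Matrix (Fin m) (Fin m) ℝ}
  {S : Matrix (Fin n) (Fin n) ℝ}

lemma posDef_innovationCov (hS : S.PosSemidef) (hR : R.PosDef) : (C * S * Cᵀ + R).PosDef := by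
  have h : (C * S * Cᵀ).PosSemidef := by simpa using hS.mul_mul_conjTranspose_same C
  exact Matrix.PosDef.posSemidef_add h hR

lemma kalmanGain_mul (hS : S.PosSemidef) (hR : R.PosDef) :
    kalmanGain C R S * (C * S * Cᵀ + R) = S * Cᵀ := by
  have hW := (Matrix.isUnit_iff_isUnit_det _).1 (posDef_innovationCov (C := C) hS hR).isUnit
  rw [kalmanGain, Matrix.mul_assoc, Matrix.nonsing_inv_mul _ hW, Matrix.mul_one]

/-- The residual `e - K (C e + v)` is uncorrelated with the innovation `C e + v`. -/
lemma kalman_cross (hS : S.PosSemidef) (hR : R.PosDef) :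
    (1 - kalmanGain C R S * C) * S * Cᵀ + (-kalmanGain C R S) * R *
      (1 : Matrix (Fin m) (Fin m) ℝ)ᵀ = 0 := by
  have h := kalmanGain_mul (C := C) hS hR
  rw [Matrix.mul_add] at h
  simp only [Matrix.sub_mul, Matrix.one_mul, Matrix.transpose_one, Matrix.mul_one, Matrix.neg_mul,
    Matrix.mul_assoc] at h ⊢
  rw [← sub_eq_add_neg, sub_sub, h, sub_self]

/-- Joseph's form of the posterior covariance. -/
lemma kalmanCov_eq_joseph (hS : S.PosSemidef) (hR : R.PosDef) :
    (1 - kalmanGain C R S * C) * S * (1 - kalmanGain C R S * C)ᵀ +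
      (-kalmanGain C R S) * R * (-kalmanGain C R S)ᵀ = kalmanCov C R S := by
  have h := congrArg (· * (kalmanGain C R S)ᵀ) (kalman_cross (C := C) hS hR)
  simp only [Matrix.transpose_one, Matrix.mul_one, Matrix.add_mul, Matrix.zero_mul] at h
  rw [kalmanCov, Matrix.transpose_sub, Matrix.transpose_mul, Matrix.transpose_one,
    Matrix.transpose_neg, Matrix.mul_sub, Matrix.mul_one, Matrix.mul_neg, ← Matrix.mul_assoc,
    sub_add, sub_neg_eq_add, h, sub_zero, Matrix.sub_mul, Matrix.one_mul]

lemma posSemidef_kalmanCov (hS : S.PosSemidef) (hR : R.PosDef) :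
    (kalmanCov C R S).PosSemidef := by
  rw [← kalmanCov_eq_joseph hS hR]
  have h := (hS.mul_mul_conjTranspose_same (1 - kalmanGain C R S * C)).add
    (hR.posSemidef.mul_mul_conjTranspose_same (-kalmanGain C R S))
  rwa [Matrix.conjTranspose_eq_transpose_of_trivial,
    Matrix.conjTranspose_eq_transpose_of_trivial] at h

/-- The covariance after a silent step, in which the innovation is only known to follow the tilted
law with covariance `(W⁻¹ + Z)⁻¹`, is that of a measurement with noise covariance `R + Z⁻¹`. -/
lemma kalmanCov_add_inv (hS : S.PosSemidef) (hR : R.PosDef) (hZ : Z.PosDef) :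
    kalmanGain C R S * ((C * S * Cᵀ + R)⁻¹ + Z)⁻¹ * (kalmanGain C R S)ᵀ + kalmanCov C R S =
      kalmanCov C (R + Z⁻¹) S := by
  have hW := posDef_innovationCov (C := C) hS hR
  have hSt : Sᵀ = S := hS.1
  have hRt : Rᵀ = R := hR.1
  have hWu := (Matrix.isUnit_iff_isUnit_det _).1 hW.isUnit
  have hWt : (C * S * Cᵀ + R)⁻¹ᵀ = (C * S * Cᵀ + R)⁻¹ := hW.inv.1
  have hM := (hW.add hZ.inv).isUnit
  have hinv := Matrix.add_mul_mul_inv_eq_sub (A := (C * S * Cᵀ + R)⁻¹) (U := 1) (C := Z) (V := 1)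
    hW.inv.isUnit hZ.isUnit
    (by rw [Matrix.nonsing_inv_nonsing_inv _ hWu]; simpa [add_comm] using hM)
  rw [Matrix.nonsing_inv_nonsing_inv _ hWu] at hinv
  simp only [Matrix.one_mul, Matrix.mul_one] at hinv
  rw [hinv]
  simp only [kalmanCov, kalmanGain, Matrix.transpose_mul, hWt, hSt, Matrix.transpose_transpose]
  rw [← add_assoc (C * S * Cᵀ) R, add_comm Z⁻¹]
  set W := C * S * Cᵀ + R with hWdef
  have e1 : W⁻¹ * W = 1 := Matrix.nonsing_inv_mul _ hWu
  have e2 : W * W⁻¹ = 1 := Matrix.mul_nonsing_inv _ hWu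
  have e3 : W⁻¹ * (W - W * (W + Z⁻¹)⁻¹ * W) * W⁻¹ = W⁻¹ - (W + Z⁻¹)⁻¹ := by
    rw [Matrix.mul_sub, e1, Matrix.sub_mul, Matrix.one_mul, ← Matrix.mul_assoc,
      ← Matrix.mul_assoc, e1, Matrix.one_mul, Matrix.mul_assoc, e2, Matrix.mul_one]
  calc S * Cᵀ * W⁻¹ * (W - W * (W + Z⁻¹)⁻¹ * W) * (W⁻¹ * (C * S)) + (S - S * Cᵀ * W⁻¹ * C * S)
      = S * Cᵀ * (W⁻¹ * (W - W * (W + Z⁻¹)⁻¹ * W) * W⁻¹) * (C * S) +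
          (S - S * Cᵀ * W⁻¹ * C * S) := by simp only [Matrix.mul_assoc]
    _ = S - S * Cᵀ * (W + Z⁻¹)⁻¹ * C * S := by
        rw [e3, Matrix.mul_sub, Matrix.sub_mul]
        simp only [Matrix.mul_assoc]
        abel

/-! ### Bayes' rule for a fixed Gaussian prior -/

/-- The joint law of the innovation `z = C (x - μ) + v` and of the state `x`: the former is
Gaussian with covariance `C S C' + R`, and given it the latter is Gaussian with mean `μ + K z` and
covariance `S - K C S`. -/
lemma lintegral_innovation_state (hS : S.PosSemidef) (hR : R.PosDef)
    (μ : EuclideanSpace ℝ (Fin n))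
    {φ : EuclideanSpace ℝ (Fin m) × EuclideanSpace ℝ (Fin n) → ℝ≥0∞} (hφ : Measurable φ) :
    ∫⁻ x, ∫⁻ v, φ (mulE C (x - μ) + v, x) ∂multivariateGaussian 0 R ∂multivariateGaussian μ S =
      ∫⁻ z, ∫⁻ u, φ (z, u) ∂multivariateGaussian (μ + mulE (kalmanGain C R S) z) (kalmanCov C R S)
        ∂multivariateGaussian 0 (C * S * Cᵀ + R) := by
  have hC := measurable_mulE C
  have hK := measurable_mulE (kalmanGain C R S)
  have key := map_pair_multivariateGaussian hS hR.posSemidef (1 - kalmanGain C R S * C)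
    (-kalmanGain C R S) C 1 (kalman_cross hS hR)
  rw [kalmanCov_eq_joseph hS hR, Matrix.transpose_one, Matrix.mul_one, Matrix.one_mul] at key
  -- The first component of `key` is the residual `e - K (C e + v)`.
  have hpt : ∀ w : EuclideanSpace ℝ (Fin n) × EuclideanSpace ℝ (Fin m),
      mulE (1 - kalmanGain C R S * C) w.1 + mulE (-kalmanGain C R S) w.2 =
        w.1 - mulE (kalmanGain C R S) (mulE C w.1 + w.2) := by
    intro w
    ext i
    simp only [mulE, Matrix.sub_mulVec, Matrix.neg_mulVec, Matrix.one_mulVec,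
      ← Matrix.mulVec_mulVec, WithLp.ofLp_add, Matrix.mulVec_add, PiLp.add_apply, PiLp.sub_apply,
      Pi.sub_apply, Pi.add_apply, Pi.neg_apply]
    ring
  simp only [hpt, mulE_one] at key
  calc ∫⁻ x, ∫⁻ v, φ (mulE C (x - μ) + v, x) ∂multivariateGaussian 0 R ∂multivariateGaussian μ S
      = ∫⁻ e, ∫⁻ v, φ (mulE C e + v, μ + e) ∂multivariateGaussian 0 R
          ∂multivariateGaussian 0 S := by
        conv_lhs => rw [← add_zero μ]
        rw [lintegral_multivariateGaussian_shift _ _ _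
          (Measurable.lintegral_prod_right (by fun_prop))]
        simp
    _ = ∫⁻ w, φ (w.2, μ + mulE (kalmanGain C R S) w.2 + w.1)
          ∂(multivariateGaussian 0 (kalmanCov C R S)).prod
            (multivariateGaussian 0 (C * S * Cᵀ + R)) := by
        rw [← key, lintegral_map (by fun_prop) (by fun_prop), lintegral_prod _ (by fun_prop)]
        refine lintegral_congr fun e ↦ lintegral_congr fun v ↦ ?_
        dsimp only
        congr 2
        abel
    _ = _ := by
        rw [lintegral_prod_symm _ (by fun_prop)]
        refine lintegral_congr fun z ↦ ?_
        conv_rhs => rw [← add_zero (μ + mulE (kalmanGain C R S) z)]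
        rw [lintegral_multivariateGaussian_shift _ _ _ (by fun_prop)]

/-- Bayes' rule when nothing is transmitted: averaging the transmitted-data posterior over the
tilted innovation law gives the Gaussian law of a measurement with noise covariance
`R + Z⁻¹`, centred at the prior mean. -/
lemma lintegral_nu_mul_posterior (hS : S.PosSemidef) (hR : R.PosDef) (hZ : Z.PosDef)
    (μ : EuclideanSpace ℝ (Fin n)) {f : EuclideanSpace ℝ (Fin n) → ℝ≥0∞} (hf : Measurable f) :
    ∫⁻ z, ENNReal.ofReal (nu Z z) *
        ∫⁻ u, f u ∂multivariateGaussian (μ + mulE (kalmanGain C R S) z) (kalmanCov C R S)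
        ∂multivariateGaussian 0 (C * S * Cᵀ + R) =
      ∫⁻ z, ENNReal.ofReal (nu Z z) * ∫⁻ u, f u ∂multivariateGaussian μ (kalmanCov C (R + Z⁻¹) S)
        ∂multivariateGaussian 0 (C * S * Cᵀ + R) := by
  have hK := measurable_mulE (kalmanGain C R S)
  have hW := posDef_innovationCov (C := C) hS hR
  have hsh : ∀ z, ∫⁻ u, f u ∂multivariateGaussian (μ + mulE (kalmanGain C R S) z)
      (kalmanCov C R S) =
      ∫⁻ u, f (mulE (kalmanGain C R S) z + u) ∂multivariateGaussian μ (kalmanCov C R S) := by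
    intro z
    rw [add_comm μ, lintegral_multivariateGaussian_shift _ _ _ hf]
  simp_rw [hsh]
  rw [lintegral_nu_mul_multivariateGaussian hW hZ (Measurable.lintegral_prod_right (by fun_prop)),
    lintegral_mul_const _ (measurable_nu Z).ennreal_ofReal,
    lintegral_multivariateGaussian_linear (hW.inv.add hZ).inv.posSemidef
      (posSemidef_kalmanCov hS hR) _ _ _ hf, kalmanCov_add_inv hS hR hZ, mulE_zero_right, zero_add]

end Kalman

/-! ### Gaussian conditional laws -/

section Kernel

variable {n m p q : ℕ} {β : Type*} [MeasurableSpace β]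

lemma measurable_mulE_simpleFunc (T : SimpleFunc β (Matrix (Fin p) (Fin q) ℝ))
    {w : β → EuclideanSpace ℝ (Fin q)} (hw : Measurable w) :
    Measurable fun b ↦ mulE (T b) (w b) :=
  T.measurable_bind (fun M b ↦ mulE M (w b)) fun M ↦ (measurable_mulE M).comp hw

/-- The Gaussian law as a kernel in a parameter `b`. The covariance is a simple function of the
parameter: at each time the error covariance only depends on the finitely many past decisions. -/
noncomputable def gaussianKernel (μ : β → EuclideanSpace ℝ (Fin n)) (hμ : Measurable μ)
    (S : SimpleFunc β (Matrix (Fin n) (Fin n) ℝ)) : Kernel β (EuclideanSpace ℝ (Fin n)) where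
  toFun b := multivariateGaussian (μ b) (S b)
  measurable' := by
    refine S.measurable_bind (fun M b ↦ multivariateGaussian (μ b) M) fun M ↦ ?_
    refine Measure.measurable_of_measurable_coe _ fun s hs ↦ ?_
    have h : ∀ b, multivariateGaussian (μ b) M s =
        multivariateGaussian 0 M (Prod.mk b ⁻¹' ((fun w : β × _ ↦ μ w.1 + w.2) ⁻¹' s)) := by
      intro b
      rw [← add_zero (μ b), ← map_const_add_multivariateGaussian,
        Measure.map_apply (by fun_prop) hs]
      rfl
    simp_rw [h]
    exact measurable_measure_prodMk_left ((by fun_prop : Measurable _) hs)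

lemma gaussianKernel_apply (μ : β → EuclideanSpace ℝ (Fin n)) (hμ : Measurable μ)
    (S : SimpleFunc β (Matrix (Fin n) (Fin n) ℝ)) (b : β) :
    gaussianKernel μ hμ S b = multivariateGaussian (μ b) (S b) := rfl

instance (μ : β → EuclideanSpace ℝ (Fin n)) (hμ : Measurable μ)
    (S : SimpleFunc β (Matrix (Fin n) (Fin n) ℝ)) : IsMarkovKernel (gaussianKernel μ hμ S) :=
  ⟨fun b ↦ by rw [gaussianKernel_apply]; infer_instance⟩

lemma measurable_lintegral_multivariateGaussian {μ : β → EuclideanSpace ℝ (Fin n)}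
    (hμ : Measurable μ) (S : SimpleFunc β (Matrix (Fin n) (Fin n) ℝ))
    {f : β × EuclideanSpace ℝ (Fin n) → ℝ≥0∞} (hf : Measurable f) :
    Measurable fun b ↦ ∫⁻ u, f (b, u) ∂multivariateGaussian (μ b) (S b) :=
  hf.lintegral_kernel_prod_right' (κ := gaussianKernel μ hμ S)

variable {Ω : Type*} [MeasurableSpace Ω]

/-- The conditional law of `X` given `H` is Gaussian with mean `μ (H ω)` and covariance `S (H ω)`,
expressed through the disintegration of the joint law of `(H, X)`. -/
structure GaussianGiven (P : Measure Ω) (H : Ω → β) (X : Ω → EuclideanSpace ℝ (Fin n))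
    (μ : β → EuclideanSpace ℝ (Fin n)) (S : SimpleFunc β (Matrix (Fin n) (Fin n) ℝ)) : Prop where
  measurable_left : Measurable H
  measurable_right : Measurable X
  measurable_mean : Measurable μ
  posSemidef : ∀ b, (S b).PosSemidef
  lintegral_eq : ∀ f : β × EuclideanSpace ℝ (Fin n) → ℝ≥0∞, Measurable f →
    ∫⁻ ω, f (H ω, X ω) ∂P = ∫⁻ ω, ∫⁻ u, f (H ω, u) ∂multivariateGaussian (μ (H ω)) (S (H ω)) ∂P

namespace GaussianGiven

variable {P : Measure Ω} {H : Ω → β} {X : Ω → EuclideanSpace ℝ (Fin n)}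
  {μ : β → EuclideanSpace ℝ (Fin n)} {S : SimpleFunc β (Matrix (Fin n) (Fin n) ℝ)}

/-- Re-encoding the conditioning variable without loss of information. -/
lemma of_leftInverse {β' : Type*} [MeasurableSpace β'] {H' : Ω → β'} {g : β' → β} {e : β → β'}
    (hg : Measurable g) (he : Measurable e) (heg : Function.LeftInverse e g) (hH' : Measurable H')
    (h : GaussianGiven P (fun ω ↦ g (H' ω)) X μ S) :
    GaussianGiven P H' X (fun b ↦ μ (g b)) (S.comp g hg) where
  measurable_left := hH'
  measurable_right := h.measurable_right
  measurable_mean := h.measurable_mean.comp hg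
  posSemidef b := h.posSemidef (g b)
  lintegral_eq f hf := by
    have := h.lintegral_eq (fun w ↦ f (e w.1, w.2)) (by fun_prop)
    simp only [heg _] at this
    exact this

variable [IsProbabilityMeasure P]

lemma condDistrib_ae_eq (h : GaussianGiven P H X μ S) :
    ∀ᵐ ω ∂P, condDistrib X H P (H ω) = multivariateGaussian (μ (H ω)) (S (H ω)) := by
  have hH := h.measurable_left
  have hX := h.measurable_right
  refine ae_of_ae_map hH.aemeasurable (condDistrib_ae_eq_of_measure_eq_compProd_of_measurable
    (κ := gaussianKernel μ h.measurable_mean S) hH hX ?_)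
  refine Measure.ext_of_lintegral _ fun f hf ↦ ?_
  rw [lintegral_map hf (by fun_prop), Measure.lintegral_compProd hf]
  simp_rw [gaussianKernel_apply]
  rw [lintegral_map (measurable_lintegral_multivariateGaussian h.measurable_mean S hf) hH]
  exact h.lintegral_eq f hf

lemma condExp_ae_eq (h : GaussianGiven P H X μ S) (hX : Integrable X P) :
    P[X | MeasurableSpace.comap H inferInstance] =ᵐ[P] fun ω ↦ μ (H ω) := by
  filter_upwards [h.condDistrib_ae_eq, condExp_ae_eq_integral_condDistrib' h.measurable_left hX]
    with ω h1 h2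
  rw [h2, h1, integral_id_multivariateGaussian]

lemma condCov_ae_eq (h : GaussianGiven P H X μ S) (hX : MemLp X 2 P) :
    ∀ᵐ ω ∂P, condCov P (MeasurableSpace.comap H inferInstance) X ω = S (H ω) := by
  have hm := h.condExp_ae_eq (hX.integrable one_le_two)
  have hμ : MemLp (fun ω ↦ μ (H ω)) 2 P := (memLp_congr_ae hm).1 (hX.condExp one_le_two)
  have hij : ∀ i j, ∀ᵐ ω ∂P,
      condCov P (MeasurableSpace.comap H inferInstance) X ω i j = S (H ω) i j := by
    intro i j
    set f : β × EuclideanSpace ℝ (Fin n) → ℝ := fun w ↦ (w.2 - μ w.1) i * (w.2 - μ w.1) j with hf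
    have hfm : Measurable f := by
      have := h.measurable_mean
      fun_prop
    have hcoord : ∀ l, MemLp (fun ω ↦ (X ω - μ (H ω)) l) 2 P := fun l ↦
      (EuclideanSpace.proj (𝕜 := ℝ) l).comp_memLp' (hX.sub hμ)
    have hint : Integrable (fun ω ↦ f (H ω, X ω)) P := (hcoord i).integrable_mul (hcoord j)
    have hcongr : (fun ω' ↦ (X ω' - (P[X | MeasurableSpace.comap H inferInstance]) ω') i *
        (X ω' - (P[X | MeasurableSpace.comap H inferInstance]) ω') j) =ᵐ[P]
          fun ω' ↦ f (H ω', X ω') := by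
      filter_upwards [hm] with ω hω
      rw [hω]
    filter_upwards [h.condDistrib_ae_eq, condExp_congr_ae hcongr,
      condExp_prod_ae_eq_integral_condDistrib h.measurable_left h.measurable_right.aemeasurable
        hfm.stronglyMeasurable hint] with ω h1 h2 h3
    rw [condCov, Matrix.of_apply, h2, h3, h1,
      ← covariance_eval_multivariateGaussian (μ := μ (H ω)) (h.posSemidef (H ω)), covariance]
    have hmean : ∀ l, ∫ u, u l ∂multivariateGaussian (μ (H ω)) (S (H ω)) = μ (H ω) l := by
      intro l
      have := (EuclideanSpace.proj (𝕜 := ℝ) l).integral_comp_comm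
        (IsGaussian.integrable_fun_id (μ := multivariateGaussian (μ (H ω)) (S (H ω))))
      rw [integral_id_multivariateGaussian] at this
      exact this
    simp only [hmean]
    rfl
  filter_upwards [ae_all_iff.2 fun i ↦ ae_all_iff.2 (hij i)] with ω hω
  exact Matrix.ext hω

lemma isCondGaussian (h : GaussianGiven P H X μ S) {a : Ω → EuclideanSpace ℝ (Fin n)}
    {T : Ω → Matrix (Fin n) (Fin n) ℝ} (ha : ∀ᵐ ω ∂P, a ω = μ (H ω))
    (hT : ∀ᵐ ω ∂P, T ω = S (H ω)) : IsCondGaussian P X H a T := by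
  filter_upwards [h.condDistrib_ae_eq, ha, hT] with ω h1 h2 h3
  rw [h2, h3]
  exact ⟨h.posSemidef _, h1⟩

/-- Integrating out a noise `V` independent of `(H, X)`. -/
lemma lintegral_eq_of_indepFun (h : GaussianGiven P H X μ S) {δ : Type*} [MeasurableSpace δ]
    {V : Ω → δ} (hV : Measurable V) (hind : IndepFun (fun ω ↦ (H ω, X ω)) V P)
    {f : (β × EuclideanSpace ℝ (Fin n)) × δ → ℝ≥0∞} (hf : Measurable f) :
    ∫⁻ ω, f ((H ω, X ω), V ω) ∂P =
      ∫⁻ ω, ∫⁻ u, ∫⁻ v, f ((H ω, u), v) ∂P.map V ∂multivariateGaussian (μ (H ω)) (S (H ω)) ∂P := by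
  have hH := h.measurable_left
  have hX := h.measurable_right
  have := Measure.isProbabilityMeasure_map hV.aemeasurable (μ := P)
  rw [← h.lintegral_eq (fun w ↦ ∫⁻ v, f (w, v) ∂P.map V) hf.lintegral_prod_right',
    ← lintegral_map (f := f) (g := fun ω ↦ ((H ω, X ω), V ω)) hf (by fun_prop),
    (indepFun_iff_map_prod_eq_prod_map_map (by fun_prop) (by fun_prop)).1 hind,
    lintegral_prod _ (by fun_prop), lintegral_map (by fun_prop) (by fun_prop)]

/-- The time update. -/
lemma time_update (h : GaussianGiven P H X μ S) {A : Matrix (Fin p) (Fin n) ℝ}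
    {Q : Matrix (Fin p) (Fin p) ℝ} (hQ : Q.PosSemidef) {W : Ω → EuclideanSpace ℝ (Fin p)}
    (hW : Measurable W) (hWlaw : P.map W = multivariateGaussian 0 Q)
    (hind : IndepFun (fun ω ↦ (H ω, X ω)) W P) :
    GaussianGiven P H (fun ω ↦ mulE A (X ω) + W ω) (fun b ↦ mulE A (μ b))
      (S.map fun M ↦ A * M * Aᵀ + Q) where
  measurable_left := h.measurable_left
  measurable_right := ((measurable_mulE A).comp h.measurable_right).add hW
  measurable_mean := (measurable_mulE A).comp h.measurable_mean
  posSemidef b := by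
    have := (h.posSemidef b).mul_mul_conjTranspose_same A
    rw [Matrix.conjTranspose_eq_transpose_of_trivial] at this
    exact this.add hQ
  lintegral_eq f hf := by
    have hA := measurable_mulE A
    rw [h.lintegral_eq_of_indepFun (f := fun w ↦ f (w.1.1, mulE A w.1.2 + w.2)) hW hind
      (by fun_prop), hWlaw]
    refine lintegral_congr fun ω ↦ ?_
    rw [lintegral_multivariateGaussian_linear (f := fun x ↦ f (H ω, x)) (h.posSemidef _) hQ _ _ _
      (by fun_prop), add_zero, SimpleFunc.map_apply]

end GaussianGiven

end Kernel

/-! ### The measurement update under the stochastic trigger -/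

section Trigger

variable {n m : ℕ} {β : Type*} [MeasurableSpace β] {Ω : Type*} [MeasurableSpace Ω]

lemma nu_le_one {Z : Matrix (Fin m) (Fin m) ℝ} (hZ : Z.PosSemidef)
    (z : EuclideanSpace ℝ (Fin m)) : nu Z z ≤ 1 := by
  have : 0 ≤ z.ofLp ⬝ᵥ Z *ᵥ z.ofLp := by simpa using hZ.dotProduct_mulVec_nonneg z.ofLp
  exact Real.exp_le_one_iff.2 (by linarith)

lemma lintegral_uniform_threshold {a : ℝ} (h0 : 0 ≤ a) (h1 : a ≤ 1) (c d : ℝ≥0∞) :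
    ∫⁻ t, (if t ≤ a then c else d) ∂(volume.restrict (Set.Icc (0 : ℝ) 1)) =
      ENNReal.ofReal a * c + ENNReal.ofReal (1 - a) * d := by
  have : (fun t : ℝ ↦ if t ≤ a then c else d) = fun t ↦
      (Set.Iic a).indicator (fun _ ↦ c) t + (Set.Ioi a).indicator (fun _ ↦ d) t := by
    funext t
    by_cases ht : t ≤ a
    · simp [ht]
    · simp [ht, not_le.1 ht]
  rw [this, lintegral_add_left (by fun_prop (disch := measurability)),
    lintegral_indicator measurableSet_Iic, lintegral_indicator measurableSet_Ioi,
    lintegral_const, lintegral_const, Measure.restrict_restrict measurableSet_Iic,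
    Measure.restrict_restrict measurableSet_Ioi, Measure.restrict_apply_univ,
    Measure.restrict_apply_univ]
  have e1 : Set.Iic a ∩ Set.Icc 0 1 = Set.Icc 0 a := by
    ext t; simp only [Set.mem_inter_iff, Set.mem_Iic, Set.mem_Icc]; grind
  have e2 : Set.Ioi a ∩ Set.Icc 0 1 = Set.Ioc a 1 := by
    ext t; simp only [Set.mem_inter_iff, Set.mem_Ioi, Set.mem_Icc, Set.mem_Ioc]; grind
  rw [e1, e2, Real.volume_Icc, Real.volume_Ioc, sub_zero, mul_comm c, mul_comm d]

/-- The posterior mean as a function of the old data `w.1`, the decision `w.2.1` and the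
transmitted value `w.2.2`, which is only read when the decision is nonzero. -/
noncomputable def updatedMean (C : Matrix (Fin m) (Fin n) ℝ) (R : Matrix (Fin m) (Fin m) ℝ)
    (μ : β → EuclideanSpace ℝ (Fin n)) (S : SimpleFunc β (Matrix (Fin n) (Fin n) ℝ))
    (w : β × (ℝ × EuclideanSpace ℝ (Fin m))) : EuclideanSpace ℝ (Fin n) :=
  open Classical in
  if w.2.1 = 0 then μ w.1 else
    μ w.1 + mulE (kalmanGain C R (S w.1)) (w.2.2 - mulE C (μ w.1))

lemma measurableSet_silent :
    MeasurableSet {w : β × (ℝ × EuclideanSpace ℝ (Fin m)) | w.2.1 = 0} :=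
  measurableSet_eq_fun (by fun_prop) (by fun_prop)

/-- The posterior covariance as a function of the old data and the decision: a silent step counts
as a measurement whose noise covariance is increased by `Z⁻¹`. -/
noncomputable def updatedCov (C : Matrix (Fin m) (Fin n) ℝ) (R Z : Matrix (Fin m) (Fin m) ℝ)
    (S : SimpleFunc β (Matrix (Fin n) (Fin n) ℝ)) :
    SimpleFunc (β × (ℝ × EuclideanSpace ℝ (Fin m))) (Matrix (Fin n) (Fin n) ℝ) :=
  SimpleFunc.piecewise {w | w.2.1 = 0} measurableSet_silent
    ((S.comp Prod.fst measurable_fst).map (kalmanCov C (R + Z⁻¹)))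
    ((S.comp Prod.fst measurable_fst).map (kalmanCov C R))

variable {C : Matrix (Fin m) (Fin n) ℝ} {R Z : Matrix (Fin m) (Fin m) ℝ}
  {μ : β → EuclideanSpace ℝ (Fin n)} {S : SimpleFunc β (Matrix (Fin n) (Fin n) ℝ)}

lemma updatedMean_silent (b : β) (y : EuclideanSpace ℝ (Fin m)) :
    updatedMean C R μ S (b, 0, y) = μ b := by simp [updatedMean]

lemma updatedMean_sent (b : β) (y : EuclideanSpace ℝ (Fin m)) :
    updatedMean C R μ S (b, 1, y) = μ b + mulE (kalmanGain C R (S b)) (y - mulE C (μ b)) := by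
  simp [updatedMean]

lemma updatedCov_silent (b : β) (y : EuclideanSpace ℝ (Fin m)) :
    updatedCov C R Z S (b, 0, y) = kalmanCov C (R + Z⁻¹) (S b) := by
  simp [updatedCov, SimpleFunc.coe_piecewise]

lemma updatedCov_sent (b : β) (y : EuclideanSpace ℝ (Fin m)) :
    updatedCov C R Z S (b, 1, y) = kalmanCov C R (S b) := by
  simp [updatedCov, SimpleFunc.coe_piecewise]

lemma measurable_updatedMean (hμ : Measurable μ) : Measurable (updatedMean C R μ S) := by
  have hC := measurable_mulE C
  refine Measurable.ite measurableSet_silent (by fun_prop) ?_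
  refine (hμ.comp measurable_fst).add ?_
  exact measurable_mulE_simpleFunc ((S.comp Prod.fst measurable_fst).map (kalmanGain C R))
    (by fun_prop)

lemma posSemidef_updatedCov (hS : ∀ b, (S b).PosSemidef) (hR : R.PosDef) (hZ : Z.PosDef)
    (w : β × (ℝ × EuclideanSpace ℝ (Fin m))) : (updatedCov C R Z S w).PosSemidef := by
  rw [updatedCov, SimpleFunc.coe_piecewise]
  by_cases h : w ∈ {w : β × (ℝ × EuclideanSpace ℝ (Fin m)) | w.2.1 = 0}
  · rw [Set.piecewise_eq_of_mem _ _ _ h]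
    exact posSemidef_kalmanCov (hS _) (hR.add hZ.inv)
  · rw [Set.piecewise_eq_of_notMem _ _ _ h]
    exact posSemidef_kalmanCov (hS _) hR

namespace GaussianGiven

variable {P : Measure Ω} [IsProbabilityMeasure P] {H : Ω → β} {X : Ω → EuclideanSpace ℝ (Fin n)}

/-- The measurement update under the stochastic trigger. -/
lemma measurement_update (h : GaussianGiven P H X μ S) (hR : R.PosDef) (hZ : Z.PosDef)
    {V : Ω → EuclideanSpace ℝ (Fin m)} {ζ γ : Ω → ℝ} (hV : Measurable V) (hζ : Measurable ζ)
    (hγ : Measurable γ) (hVlaw : P.map V = multivariateGaussian 0 R)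
    (hζlaw : P.map ζ = volume.restrict (Set.Icc (0 : ℝ) 1))
    (hind : IndepFun (fun ω ↦ (H ω, X ω)) (fun ω ↦ (V ω, ζ ω)) P) (hVζ : IndepFun V ζ P)
    (htrig : ∀ᵐ ω ∂P,
      γ ω = if ζ ω ≤ nu Z (mulE C (X ω) + V ω - mulE C (μ (H ω))) then 0 else 1) :
    GaussianGiven P (fun ω ↦ (H ω, γ ω, γ ω • (mulE C (X ω) + V ω))) X
      (updatedMean C R μ S) (updatedCov C R Z S) := by
  have hC := measurable_mulE C
  have hH := h.measurable_left
  have hX := h.measurable_right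
  have hμ := h.measurable_mean
  have hν := measurable_nu Z
  have hm' : Measurable (updatedMean C R μ S) := measurable_updatedMean hμ
  -- The conditional expectation of `f (H, γ, γ y, x)` given the new data.
  set F : (((β × (ℝ × EuclideanSpace ℝ (Fin m))) × EuclideanSpace ℝ (Fin n)) → ℝ≥0∞) →
      β × (ℝ × EuclideanSpace ℝ (Fin m)) → ℝ≥0∞ := fun f w ↦
    ∫⁻ u, f (w, u) ∂multivariateGaussian (updatedMean C R μ S w) (updatedCov C R Z S w) with hF
  have hFm : ∀ f, Measurable f → Measurable (F f) := fun f hf ↦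
    measurable_lintegral_multivariateGaussian hm' _ hf
  -- Expectations of functions of the new data and the state, computed through the innovation `z`.
  have key : ∀ f, Measurable f →
      ∫⁻ ω, f ((H ω, γ ω, γ ω • (mulE C (X ω) + V ω)), X ω) ∂P =
        ∫⁻ ω, ∫⁻ z, (ENNReal.ofReal (nu Z z) * F f (H ω, 0, 0) +
          ENNReal.ofReal (1 - nu Z z) * F f (H ω, 1, z + mulE C (μ (H ω))))
            ∂multivariateGaussian 0 (C * S (H ω) * Cᵀ + R) ∂P := by
    intro f hf
    set g : (β × EuclideanSpace ℝ (Fin n)) × (EuclideanSpace ℝ (Fin m) × ℝ) → ℝ≥0∞ := fun w ↦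
      if w.2.2 ≤ nu Z (mulE C w.1.2 + w.2.1 - mulE C (μ w.1.1)) then f ((w.1.1, 0, 0), w.1.2)
      else f ((w.1.1, 1, mulE C w.1.2 + w.2.1), w.1.2) with hg
    have hgm : Measurable g :=
      Measurable.ite (measurableSet_le (by fun_prop) (by fun_prop)) (by fun_prop) (by fun_prop)
    have e1 : ∫⁻ ω, f ((H ω, γ ω, γ ω • (mulE C (X ω) + V ω)), X ω) ∂P =
        ∫⁻ ω, g ((H ω, X ω), (V ω, ζ ω)) ∂P := by
      refine lintegral_congr_ae ?_
      filter_upwards [htrig] with ω hω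
      rw [hω, hg]
      dsimp only
      split_ifs <;> simp
    rw [e1, h.lintegral_eq_of_indepFun (hV.prodMk hζ) hind hgm,
      (indepFun_iff_map_prod_eq_prod_map_map hV.aemeasurable hζ.aemeasurable).1 hVζ, hVlaw, hζlaw]
    refine lintegral_congr fun ω ↦ ?_
    set b := H ω
    set φ : EuclideanSpace ℝ (Fin m) × EuclideanSpace ℝ (Fin n) → ℝ≥0∞ := fun w ↦
      ENNReal.ofReal (nu Z w.1) * f ((b, 0, 0), w.2) +
        ENNReal.ofReal (1 - nu Z w.1) * f ((b, 1, w.1 + mulE C (μ b)), w.2) with hφ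
    have hφm : Measurable φ := by fun_prop
    -- Integrating out the uniform variable turns the trigger into the weights `ν(z)`, `1 - ν(z)`.
    have e2 : ∀ x, ∫⁻ v, g ((b, x), v)
        ∂(multivariateGaussian 0 R).prod (volume.restrict (Set.Icc (0 : ℝ) 1)) =
        ∫⁻ v, φ (mulE C (x - μ b) + v, x) ∂multivariateGaussian 0 R := by
      intro x
      rw [lintegral_prod _ (by fun_prop)]
      refine lintegral_congr fun v ↦ ?_
      have hz : mulE C x + v - mulE C (μ b) = mulE C (x - μ b) + v := by rw [mulE_sub]; abel
      have hy : mulE C (x - μ b) + v + mulE C (μ b) = mulE C x + v := by rw [mulE_sub]; abel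
      simp only [hg, hφ, hz, hy]
      exact lintegral_uniform_threshold (nu_nonneg _ _) (nu_le_one hZ.posSemidef _) _ _
    simp_rw [e2]
    rw [lintegral_innovation_state (h.posSemidef b) hR _ hφm]
    have hK := measurable_mulE (kalmanGain C R (S b))
    have hmeas : ∀ ψ : EuclideanSpace ℝ (Fin m) × EuclideanSpace ℝ (Fin n) → ℝ≥0∞, Measurable ψ →
        Measurable fun z ↦ ∫⁻ u, ψ (z, u) ∂multivariateGaussian
          (μ b + mulE (kalmanGain C R (S b)) z) (kalmanCov C R (S b)) := fun ψ hψ ↦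
      measurable_lintegral_multivariateGaussian (by fun_prop) (SimpleFunc.const _ _) hψ
    have hm1 := hmeas (fun w ↦ f ((b, 0, 0), w.2)) (by fun_prop)
    have hm2 := hmeas (fun w ↦ f ((b, 1, w.1 + mulE C (μ b)), w.2)) (by fun_prop)
    have e3 : ∀ z, ∫⁻ u, φ (z, u) ∂multivariateGaussian
          (μ b + mulE (kalmanGain C R (S b)) z) (kalmanCov C R (S b)) =
        ENNReal.ofReal (nu Z z) * ∫⁻ u, f ((b, 0, 0), u) ∂multivariateGaussian
          (μ b + mulE (kalmanGain C R (S b)) z) (kalmanCov C R (S b)) +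
        ENNReal.ofReal (1 - nu Z z) * F f (b, 1, z + mulE C (μ b)) := by
      intro z
      simp only [hφ, hF]
      rw [lintegral_add_left (by fun_prop), lintegral_const_mul _ (by fun_prop),
        lintegral_const_mul _ (by fun_prop), updatedMean_sent, updatedCov_sent,
        add_sub_cancel_right]
    simp_rw [e3]
    rw [lintegral_add_left (by fun_prop), lintegral_nu_mul_posterior (h.posSemidef b) hR hZ _
      (by fun_prop), lintegral_add_left (by fun_prop)]
    simp only [hF, updatedMean_silent, updatedCov_silent]
  refine ⟨by fun_prop, hX, hm', posSemidef_updatedCov h.posSemidef hR hZ, fun f hf ↦ ?_⟩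
  -- `F f` does not depend on the state, so `key` evaluates its expectation to the same value.
  have hFF : F (fun w ↦ F f w.1) = F f := by
    funext w
    simp [hF]
  rw [key f hf]
  have := key (fun w ↦ F f w.1) ((hFm f hf).comp measurable_fst)
  rw [hFF] at this
  exact this.symm

end GaussianGiven

end Trigger

/-! ### Independence of the past and the new noises -/

section System

variable {Ω : Type*} {n m : ℕ}

/-- The σ-algebras generated by `x₀`, the `w_k`, the `v_k` and the `ζ_k`. -/
@[reducible]
def noise (x w : ℕ → Ω → EuclideanSpace ℝ (Fin n)) (v : ℕ → Ω → EuclideanSpace ℝ (Fin m))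
    (ζ : ℕ → Ω → ℝ) : Unit ⊕ ℕ ⊕ ℕ ⊕ ℕ → MeasurableSpace Ω :=
  Sum.elim (fun _ : Unit => MeasurableSpace.comap (x 0) inferInstance)
    (Sum.elim (fun k : ℕ => MeasurableSpace.comap (w k) inferInstance)
      (Sum.elim (fun k : ℕ => MeasurableSpace.comap (v k) inferInstance)
        (fun k : ℕ => MeasurableSpace.comap (ζ k) inferInstance)))

/-- Indices of `x₀`, of the `w_j` with `j < a`, and of the `v_j` and `ζ_j` with `j < b`. -/
def pastIndex (a b : ℕ) : Set (Unit ⊕ ℕ ⊕ ℕ ⊕ ℕ) :=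
  {i | Sum.elim (fun _ ↦ True) (Sum.elim (· < a) (Sum.elim (· < b) (· < b))) i}

/-- The σ-algebra generated by `x₀`, the `w_j` with `j < a`, and the `v_j` and `ζ_j` with
`j < b`. -/
@[reducible]
def past (x w : ℕ → Ω → EuclideanSpace ℝ (Fin n)) (v : ℕ → Ω → EuclideanSpace ℝ (Fin m))
    (ζ : ℕ → Ω → ℝ) (a b : ℕ) : MeasurableSpace Ω :=
  ⨆ i ∈ pastIndex a b, noise x w v ζ i

section Past

variable {x w : ℕ → Ω → EuclideanSpace ℝ (Fin n)} {v : ℕ → Ω → EuclideanSpace ℝ (Fin m)}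
  {ζ : ℕ → Ω → ℝ}

lemma past_mono {a b a' b' : ℕ} (ha : a ≤ a') (hb : b ≤ b') :
    past x w v ζ a b ≤ past x w v ζ a' b' := by
  refine biSup_mono fun i hi ↦ ?_
  rcases i with _ | i | i | i
  · exact hi
  · exact lt_of_lt_of_le hi ha
  · exact lt_of_lt_of_le hi hb
  · exact lt_of_lt_of_le hi hb

lemma measurable_past_init (a b : ℕ) : Measurable[past x w v ζ a b] (x 0) :=
  measurable_iff_comap_le.2 (le_iSup₂_of_le (f := fun i _ ↦ noise x w v ζ i)
    (Sum.inl ()) trivial le_rfl)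

lemma measurable_past_w {a b j : ℕ} (h : j < a) : Measurable[past x w v ζ a b] (w j) :=
  measurable_iff_comap_le.2 (le_iSup₂_of_le (f := fun i _ ↦ noise x w v ζ i)
    (Sum.inr (Sum.inl j)) h le_rfl)

lemma measurable_past_v {a b j : ℕ} (h : j < b) : Measurable[past x w v ζ a b] (v j) :=
  measurable_iff_comap_le.2 (le_iSup₂_of_le (f := fun i _ ↦ noise x w v ζ i)
    (Sum.inr (Sum.inr (Sum.inl j))) h le_rfl)

lemma measurable_past_ζ {a b j : ℕ} (h : j < b) : Measurable[past x w v ζ a b] (ζ j) :=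
  measurable_iff_comap_le.2 (le_iSup₂_of_le (f := fun i _ ↦ noise x w v ζ i)
    (Sum.inr (Sum.inr (Sum.inr j))) h le_rfl)

end Past

namespace IsClosedLoopSystem

variable [MeasurableSpace Ω] {P : Measure Ω} {A : Matrix (Fin n) (Fin n) ℝ}
  {C : Matrix (Fin m) (Fin n) ℝ}
  {Q S₀ : Matrix (Fin n) (Fin n) ℝ} {R Z : Matrix (Fin m) (Fin m) ℝ}
  {x w : ℕ → Ω → EuclideanSpace ℝ (Fin n)} {y v : ℕ → Ω → EuclideanSpace ℝ (Fin m)}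
  {ζ γ : ℕ → Ω → ℝ}

lemma noise_le (h : IsClosedLoopSystem P A C Q S₀ R Z x w y v ζ γ) (i : Unit ⊕ ℕ ⊕ ℕ ⊕ ℕ) :
    noise x w v ζ i ≤ (inferInstance : MeasurableSpace Ω) := by
  rcases i with _ | i | i | i
  · exact h.measurable_init.comap_le
  · exact (h.measurable_w i).comap_le
  · exact (h.measurable_v i).comap_le
  · exact (h.measurable_ζ i).comap_le

lemma past_le (h : IsClosedLoopSystem P A C Q S₀ R Z x w y v ζ γ) (a b : ℕ) :
    past x w v ζ a b ≤ (inferInstance : MeasurableSpace Ω) :=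
  iSup₂_le fun i _ ↦ h.noise_le i

lemma measurable_past_x (h : IsClosedLoopSystem P A C Q S₀ R Z x w y v ζ γ) (k b : ℕ) :
    Measurable[past x w v ζ k b] (x k) := by
  induction k with
  | zero => exact measurable_past_init _ _
  | succ k ih =>
    rw [show x (k + 1) = fun ω ↦ mulE A (x k ω) + w k ω from funext (h.state_eq k)]
    exact ((measurable_mulE A).comp (ih.mono (past_mono k.le_succ le_rfl) le_rfl)).add
      (measurable_past_w k.lt_succ_self)

lemma measurable_past_y (h : IsClosedLoopSystem P A C Q S₀ R Z x w y v ζ γ) (k : ℕ) :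
    Measurable[past x w v ζ k (k + 1)] (y k) := by
  rw [show y k = fun ω ↦ mulE C (x k ω) + v k ω from funext (h.output_eq k)]
  exact ((measurable_mulE C).comp (h.measurable_past_x k _)).add
    (measurable_past_v k.lt_succ_self)

lemma measurable_y (h : IsClosedLoopSystem P A C Q S₀ R Z x w y v ζ γ) (k : ℕ) :
    Measurable (y k) := (h.measurable_past_y k).mono (h.past_le _ _) le_rfl

lemma measurable_hist (h : IsClosedLoopSystem P A C Q S₀ R Z x w y v ζ γ) (k : ℕ) :
    Measurable (hist γ y k) :=
  measurable_pi_lambda _ fun j ↦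
    (h.measurable_γ j).prodMk ((h.measurable_γ j).smul (h.measurable_y j))

lemma exists_hist_version (h : IsClosedLoopSystem P A C Q S₀ R Z x w y v ζ γ) {k a : ℕ}
    (ha : k ≤ a + 1)
    (hγ : ∀ j < k, ∃ g, Measurable[past x w v ζ j (j + 1)] g ∧ γ j =ᵐ[P] g) :
    ∃ H', Measurable[past x w v ζ a k] H' ∧ hist γ y k =ᵐ[P] H' := by
  choose! g hg hγg using hγ
  refine ⟨hist g y k, ?_, ?_⟩
  · refine @measurable_pi_lambda _ _ _ (past x w v ζ a k) _ _ fun j ↦ ?_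
    have hle : past x w v ζ j (j + 1) ≤ past x w v ζ a k := past_mono (by omega) j.2
    have h1 := (hg j j.2).mono hle le_rfl
    exact h1.prodMk (h1.smul ((h.measurable_past_y j).mono hle le_rfl))
  · filter_upwards [ae_all_iff.2 fun j : Fin k ↦ hγg j j.2] with ω hω
    funext j
    simp only [hist, hω j]

/-- Up to a null set, each decision is a function of the noises that have occurred so far. The
null set comes from the trigger, which is only prescribed almost surely. -/
lemma exists_γ_version (h : IsClosedLoopSystem P A C Q S₀ R Z x w y v ζ γ) (k : ℕ) :
    ∃ g, Measurable[past x w v ζ k (k + 1)] g ∧ γ k =ᵐ[P] g := by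
  induction k using Nat.strong_induction_on with
  | _ k ih =>
    obtain ⟨H', hH', hH⟩ := h.exists_hist_version (a := k) (by omega) ih
    obtain ⟨φ, hφ, hyφ⟩ := (stronglyMeasurable_condExp (f := y k) (m := info γ y k)
      (μ := P)).measurable.exists_eq_measurable_comp
    have hν := measurable_nu Z
    have hH'' := hH'.mono (past_mono le_rfl k.le_succ) le_rfl
    refine ⟨fun ω ↦ if ζ k ω ≤ nu Z (y k ω - φ (H' ω)) then 0 else 1, ?_, ?_⟩
    · refine Measurable.ite ?_ measurable_const measurable_const
      exact @measurableSet_le _ _ _ _ _ (past x w v ζ k (k + 1)) _ _ _ _ _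
        (measurable_past_ζ k.lt_succ_self)
        (hν.comp ((h.measurable_past_y k).sub (hφ.comp hH'')))
    · filter_upwards [h.trigger k, hH] with ω h1 h2
      rw [h1, innovation, hyφ, Function.comp_apply, h2]

lemma exists_hist_version' (h : IsClosedLoopSystem P A C Q S₀ R Z x w y v ζ γ) {k a : ℕ}
    (ha : k ≤ a + 1) : ∃ H', Measurable[past x w v ζ a k] H' ∧ hist γ y k =ᵐ[P] H' :=
  h.exists_hist_version ha fun j _ ↦ h.exists_γ_version j

/-- The pair of the data strictly before time `b` and the state `x_k` is independent of every random
variable generated by noises that are not among `x₀`, `w_j` with `j < k`, and `v_j`, `ζ_j` with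
`j < b`. -/
lemma indepFun_past (h : IsClosedLoopSystem P A C Q S₀ R Z x w y v ζ γ) {k b : ℕ}
    (hb : b ≤ k + 1) {T : Set (Unit ⊕ ℕ ⊕ ℕ ⊕ ℕ)} (hT : Disjoint (pastIndex k b) T)
    {δ : Type*} [MeasurableSpace δ] {V : Ω → δ}
    (hV : Measurable[⨆ i ∈ T, noise x w v ζ i] V) :
    IndepFun (fun ω ↦ (hist γ y b ω, x k ω)) V P := by
  obtain ⟨H', hH', hH⟩ := h.exists_hist_version' hb
  have hind : Indep (past x w v ζ k b) (⨆ i ∈ T, noise x w v ζ i) P :=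
    indep_iSup_of_disjoint h.noise_le h.indep hT
  have h1 : IndepFun (fun ω ↦ (H' ω, x k ω)) V P := by
    rw [IndepFun_iff_Indep]
    exact indep_of_indep_of_le hind
      (measurable_iff_comap_le.1 (hH'.prodMk (h.measurable_past_x k b)))
      (measurable_iff_comap_le.1 hV)
  refine h1.congr ?_ .rfl
  filter_upwards [hH] with ω hω
  rw [hω]

lemma indepFun_v_ζ (h : IsClosedLoopSystem P A C Q S₀ R Z x w y v ζ γ) (k : ℕ) :
    IndepFun (fun ω ↦ (hist γ y k ω, x k ω)) (fun ω ↦ (v k ω, ζ k ω)) P := by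
  refine h.indepFun_past k.le_succ (T := {Sum.inr (Sum.inr (Sum.inl k)),
    Sum.inr (Sum.inr (Sum.inr k))}) ?_ ?_
  · rw [Set.disjoint_right]
    rintro i (rfl | rfl) <;> exact lt_irrefl k
  · have e1 : Measurable[⨆ i ∈ ({Sum.inr (Sum.inr (Sum.inl k)), Sum.inr (Sum.inr (Sum.inr k))} :
        Set (Unit ⊕ ℕ ⊕ ℕ ⊕ ℕ)), noise x w v ζ i] (v k) :=
      measurable_iff_comap_le.2 (le_iSup₂_of_le (f := fun i _ ↦ noise x w v ζ i)
        (Sum.inr (Sum.inr (Sum.inl k))) (by simp) le_rfl)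
    have e2 : Measurable[⨆ i ∈ ({Sum.inr (Sum.inr (Sum.inl k)), Sum.inr (Sum.inr (Sum.inr k))} :
        Set (Unit ⊕ ℕ ⊕ ℕ ⊕ ℕ)), noise x w v ζ i] (ζ k) :=
      measurable_iff_comap_le.2 (le_iSup₂_of_le (f := fun i _ ↦ noise x w v ζ i)
        (Sum.inr (Sum.inr (Sum.inr k))) (by simp) le_rfl)
    exact e1.prodMk e2

lemma indepFun_w (h : IsClosedLoopSystem P A C Q S₀ R Z x w y v ζ γ) (k : ℕ) :
    IndepFun (fun ω ↦ (hist γ y (k + 1) ω, x k ω)) (w k) P := by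
  refine h.indepFun_past le_rfl (T := {Sum.inr (Sum.inl k)}) ?_ ?_
  · rw [Set.disjoint_right]
    rintro i rfl
    exact lt_irrefl k
  · exact measurable_iff_comap_le.2 (le_iSup₂_of_le (f := fun i _ ↦ noise x w v ζ i)
      (Sum.inr (Sum.inl k)) rfl le_rfl)

lemma indepFun_v_of_ζ (h : IsClosedLoopSystem P A C Q S₀ R Z x w y v ζ γ) (k : ℕ) :
    IndepFun (v k) (ζ k) P := by
  rw [IndepFun_iff_Indep]
  exact h.indep.indep (i := Sum.inr (Sum.inr (Sum.inl k))) (j := Sum.inr (Sum.inr (Sum.inr k)))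
    (by simp)

/-! ### The recursion -/

lemma memLp_of_map_eq {l : ℕ} {X : Ω → EuclideanSpace ℝ (Fin l)} (hX : Measurable X)
    {a : EuclideanSpace ℝ (Fin l)} {S : Matrix (Fin l) (Fin l) ℝ}
    (hlaw : P.map X = multivariateGaussian a S) : MemLp X 2 P :=
  (memLp_map_measure_iff (f := X) (g := id) aestronglyMeasurable_id hX.aemeasurable).1
    (hlaw ▸ IsGaussian.memLp_two_id)

lemma memLp_x (h : IsClosedLoopSystem P A C Q S₀ R Z x w y v ζ γ) (k : ℕ) :
    MemLp (x k) 2 P := by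
  induction k with
  | zero => exact memLp_of_map_eq h.measurable_init h.law_init
  | succ k ih =>
    rw [show x (k + 1) = fun ω ↦ mulE A (x k ω) + w k ω from funext (h.state_eq k)]
    exact ((mulCLM A).comp_memLp' ih).add (memLp_of_map_eq (h.measurable_w k) (h.law_w k))

lemma memLp_v (h : IsClosedLoopSystem P A C Q S₀ R Z x w y v ζ γ) (k : ℕ) :
    MemLp (v k) 2 P := memLp_of_map_eq (h.measurable_v k) (h.law_v k)

lemma memLp_y (h : IsClosedLoopSystem P A C Q S₀ R Z x w y v ζ γ) (k : ℕ) :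
    MemLp (y k) 2 P := by
  rw [show y k = fun ω ↦ mulE C (x k ω) + v k ω from funext (h.output_eq k)]
  exact ((mulCLM C).comp_memLp' (h.memLp_x k)).add (h.memLp_v k)

lemma map_ζ (h : IsClosedLoopSystem P A C Q S₀ R Z x w y v ζ γ) (k : ℕ) :
    P.map (ζ k) = volume.restrict (Set.Icc (0 : ℝ) 1) := by
  have := h.law_ζ k
  rw [pdf.IsUniform, ProbabilityTheory.cond] at this
  simpa using this

variable [IsProbabilityMeasure P]

/-- The predicted output is `C x̂_k^-`, because `v_k` is centred and independent of the past. -/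
lemma condExp_y (h : IsClosedLoopSystem P A C Q S₀ R Z x w y v ζ γ) (k : ℕ) :
    ∀ᵐ ω ∂P, (P[y k | info γ y k]) ω = mulE C (priorMean P γ y x k ω) := by
  have hx := (h.memLp_x k).integrable one_le_two
  have hv := (h.memLp_v k).integrable one_le_two
  have hv0 : ∫ ω, v k ω ∂P = 0 := by
    rw [← integral_map (f := fun u ↦ u) (h.measurable_v k).aemeasurable (by fun_prop), h.law_v k,
      integral_id_multivariateGaussian]
  have hind : Indep (MeasurableSpace.comap (v k) inferInstance) (info γ y k) P := by
    rw [← IndepFun_iff_Indep]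
    exact ((h.indepFun_v_ζ k).comp measurable_fst measurable_fst).symm
  have e1 := condExp_indep_eq (h.measurable_v k).comap_le (h.measurable_hist k).comap_le
    (comap_measurable (v k)).stronglyMeasurable hind
  have e2 := (mulCLM C).comp_condExp_comm hx (m := info γ y k)
  have e3 := condExp_add ((mulCLM C).integrable_comp hx) hv (info γ y k)
  have hy : y k = (fun ω ↦ mulCLM C (x k ω)) + v k := funext (h.output_eq k)
  rw [hy]
  filter_upwards [e1, e2, e3] with ω h1 h2 h3
  rw [h3, Pi.add_apply, h1, hv0, add_zero]
  exact h2.symm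

lemma gaussianGiven_zero (h : IsClosedLoopSystem P A C Q S₀ R Z x w y v ζ γ)
    (hS₀ : S₀.PosSemidef) :
    GaussianGiven P (hist γ y 0) (x 0) (fun _ ↦ 0) (SimpleFunc.const _ S₀) where
  measurable_left := h.measurable_hist 0
  measurable_right := h.measurable_init
  measurable_mean := measurable_const
  posSemidef _ := hS₀
  lintegral_eq f hf := by
    have hH : ∀ ω, hist γ y 0 ω = default := fun ω ↦ Subsingleton.elim _ _
    simp only [hH, SimpleFunc.const_apply, lintegral_const, measure_univ, mul_one]
    rw [← h.law_init, lintegral_map (by fun_prop) h.measurable_init]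

/-- Splitting off the last observation from the data. -/
def splitLast {α : Type*} {k : ℕ} (b : Fin (k + 1) → α) : (Fin k → α) × α :=
  (Fin.init b, b (Fin.last k))

lemma measurable_splitLast {α : Type*} [MeasurableSpace α] {k : ℕ} :
    Measurable (splitLast : (Fin (k + 1) → α) → _) :=
  (measurable_pi_lambda _ fun j ↦ measurable_pi_apply j.castSucc).prodMk (measurable_pi_apply _)

lemma measurable_snoc {α : Type*} [MeasurableSpace α] {k : ℕ} :
    Measurable fun b : (Fin k → α) × α ↦ (Fin.snoc b.1 b.2 : Fin (k + 1) → α) := by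
  refine measurable_pi_lambda _ fun j ↦ ?_
  induction j using Fin.lastCases with
  | last => simpa using measurable_snd
  | cast j => simpa using! (measurable_pi_apply j).comp measurable_fst

lemma gaussianGiven_post (h : IsClosedLoopSystem P A C Q S₀ R Z x w y v ζ γ)
    (hR : R.PosDef) (hZ : Z.PosDef) {k : ℕ}
    {μ : (Fin k → ℝ × EuclideanSpace ℝ (Fin m)) → EuclideanSpace ℝ (Fin n)}
    {S : SimpleFunc (Fin k → ℝ × EuclideanSpace ℝ (Fin m)) (Matrix (Fin n) (Fin n) ℝ)}
    (hk : GaussianGiven P (hist γ y k) (x k) μ S) :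
    GaussianGiven P (hist γ y (k + 1)) (x k) (fun b ↦ updatedMean C R μ S (splitLast b))
      ((updatedCov C R Z S).comp splitLast measurable_splitLast) := by
  have hmean : ∀ᵐ ω ∂P, priorMean P γ y x k ω = μ (hist γ y k ω) :=
    hk.condExp_ae_eq ((h.memLp_x k).integrable one_le_two)
  refine GaussianGiven.of_leftInverse measurable_splitLast measurable_snoc
    (fun b ↦ Fin.snoc_init_self b) (h.measurable_hist _) ?_
  have := hk.measurement_update (C := C) (γ := γ k) hR hZ (h.measurable_v k) (h.measurable_ζ k)
    (h.measurable_γ k) (h.law_v k) (h.map_ζ k) (h.indepFun_v_ζ k) (h.indepFun_v_of_ζ k) ?_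
  · simp only [← h.output_eq] at this
    exact this
  · filter_upwards [h.trigger k, h.condExp_y k, hmean] with ω h1 h2 h3
    rw [h1, innovation, h2, h3, h.output_eq]

lemma gaussianGiven_succ (h : IsClosedLoopSystem P A C Q S₀ R Z x w y v ζ γ)
    (hQ : Q.PosSemidef) {k : ℕ}
    {μ : (Fin (k + 1) → ℝ × EuclideanSpace ℝ (Fin m)) → EuclideanSpace ℝ (Fin n)}
    {S : SimpleFunc (Fin (k + 1) → ℝ × EuclideanSpace ℝ (Fin m)) (Matrix (Fin n) (Fin n) ℝ)}
    (hk : GaussianGiven P (hist γ y (k + 1)) (x k) μ S) :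
    GaussianGiven P (hist γ y (k + 1)) (x (k + 1)) (fun b ↦ mulE A (μ b))
      (S.map fun M ↦ A * M * Aᵀ + Q) := by
  rw [show x (k + 1) = fun ω ↦ mulE A (x k ω) + w k ω from funext (h.state_eq k)]
  exact hk.time_update hQ (h.measurable_w k) (h.law_w k) (h.indepFun_w k)

lemma exists_gaussianGiven (h : IsClosedLoopSystem P A C Q S₀ R Z x w y v ζ γ)
    (hQ : Q.PosSemidef) (hR : R.PosDef) (hS₀ : S₀.PosSemidef) (hZ : Z.PosDef) (k : ℕ) :
    ∃ μ S, GaussianGiven P (hist γ y k) (x k) μ S := by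
  induction k with
  | zero => exact ⟨_, _, h.gaussianGiven_zero hS₀⟩
  | succ k ih =>
    obtain ⟨μ, S, hk⟩ := ih
    exact ⟨_, _, h.gaussianGiven_succ hQ (h.gaussianGiven_post hR hZ hk)⟩

end IsClosedLoopSystem

end System

end EventTriggered

theorem theorem2 {Ω : Type*} [MeasurableSpace Ω] (P : Measure Ω) [IsProbabilityMeasure P]
    {n m : ℕ} (A : Matrix (Fin n) (Fin n) ℝ) (C : Matrix (Fin m) (Fin n) ℝ)
    (Q S₀ : Matrix (Fin n) (Fin n) ℝ) (R Z : Matrix (Fin m) (Fin m) ℝ)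
    (hQ : Q.PosDef) (hR : R.PosDef) (hS₀ : S₀.PosDef) (hZ : Z.PosDef)
    (x w : ℕ → Ω → EuclideanSpace ℝ (Fin n)) (y v : ℕ → Ω → EuclideanSpace ℝ (Fin m))
    (ζ γ : ℕ → Ω → ℝ)
    (hsys : EventTriggered.IsClosedLoopSystem P A C Q S₀ R Z x w y v ζ γ) :
    -- the conditional means and covariances are genuine
    (∀ k, MemLp (x k) 2 P ∧ MemLp (y k) 2 P) ∧
    -- `x_k` given `I_{k-1}` is Gaussian
    (∀ k, EventTriggered.IsCondGaussian P (x k) (EventTriggered.hist γ y k)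
      (EventTriggered.priorMean P γ y x k) (EventTriggered.priorCov P γ y x k)) ∧
    -- `x_k` given `I_k` is Gaussian
    (∀ k, EventTriggered.IsCondGaussian P (x k) (EventTriggered.hist γ y (k + 1))
      (EventTriggered.postMean P γ y x k) (EventTriggered.postCov P γ y x k)) ∧
    -- initial condition
    (∀ᵐ ω ∂P, EventTriggered.priorMean P γ y x 0 ω = 0 ∧
      EventTriggered.priorCov P γ y x 0 ω = S₀) ∧
    -- time update
    (∀ k, ∀ᵐ ω ∂P,
      EventTriggered.priorMean P γ y x (k + 1) ω =
        EventTriggered.mulE A (EventTriggered.postMean P γ y x k ω) ∧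
      EventTriggered.priorCov P γ y x (k + 1) ω =
        A * EventTriggered.postCov P γ y x k ω * Aᵀ + Q) ∧
    -- measurement update
    (∀ k, ∀ᵐ ω ∂P,
      EventTriggered.postMean P γ y x k ω =
        EventTriggered.priorMean P γ y x k ω +
          γ k ω • EventTriggered.mulE
            (EventTriggered.gain C R Z (EventTriggered.priorCov P γ y x k ω) (γ k ω))
            (EventTriggered.innovation P γ y k ω) ∧
      EventTriggered.postCov P γ y x k ω =
        EventTriggered.priorCov P γ y x k ω -
          EventTriggered.gain C R Z (EventTriggered.priorCov P γ y x k ω) (γ k ω) * C *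
            EventTriggered.priorCov P γ y x k ω) := by
  have hx : ∀ k, MemLp (x k) 2 P := hsys.memLp_x
  have hxi : ∀ k, Integrable (x k) P := fun k ↦ (hx k).integrable one_le_two
  choose μ S hprior using hsys.exists_gaussianGiven hQ.posSemidef hR hS₀.posSemidef hZ
  have hpost := fun k ↦ hsys.gaussianGiven_post hR hZ (hprior k)
  have hpm : ∀ k, ∀ᵐ ω ∂P, EventTriggered.priorMean P γ y x k ω =
      μ k (EventTriggered.hist γ y k ω) := fun k ↦ (hprior k).condExp_ae_eq (hxi k)
  have hpc : ∀ k, ∀ᵐ ω ∂P, EventTriggered.priorCov P γ y x k ω =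
      S k (EventTriggered.hist γ y k ω) := fun k ↦ (hprior k).condCov_ae_eq (hx k)
  have hqm := fun k ↦ (hpost k).condExp_ae_eq (hxi k)
  have hqc := fun k ↦ (hpost k).condCov_ae_eq (hx k)
  refine ⟨fun k ↦ ⟨hx k, hsys.memLp_y k⟩, fun k ↦ (hprior k).isCondGaussian (hpm k) (hpc k),
    fun k ↦ (hpost k).isCondGaussian (hqm k) (hqc k), ?_, fun k ↦ ?_, fun k ↦ ?_⟩
  · have h0 := hsys.gaussianGiven_zero hS₀.posSemidef
    filter_upwards [h0.condExp_ae_eq (hxi 0), h0.condCov_ae_eq (hx 0)] with ω h1 h2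
    exact ⟨h1, h2⟩
  · have hs := hsys.gaussianGiven_succ hQ.posSemidef (hpost k)
    filter_upwards [hs.condExp_ae_eq (hxi (k + 1)), hs.condCov_ae_eq (hx (k + 1)), hqm k, hqc k]
      with ω h1 h2 h3 h4
    refine ⟨h1.trans ?_, h2.trans ?_⟩
    · rw [EventTriggered.postMean, h3]
    · rw [EventTriggered.postCov, h4]
      rfl
  · filter_upwards [hpm k, hpc k, hqm k, hqc k, hsys.condExp_y k, hsys.trigger k]
      with ω h1 h2 h3 h4 h5 h6
    have hsplit : EventTriggered.IsClosedLoopSystem.splitLast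
        (EventTriggered.hist γ y (k + 1) ω) =
          (EventTriggered.hist γ y k ω, γ k ω, γ k ω • y k ω) := rfl
    rw [hsplit] at h3
    rw [SimpleFunc.coe_comp, Function.comp_apply, hsplit] at h4
    rw [EventTriggered.postMean, EventTriggered.postCov, h3, h4, h2,
      EventTriggered.gain_eq_kalmanGain, h1, EventTriggered.innovation, h5, h1]
    have hγ : γ k ω = 0 ∨ γ k ω = 1 := by
      rw [h6]
      split_ifs <;> simp
    rcases hγ with hγ | hγ
    · rw [hγ, EventTriggered.updatedMean_silent, EventTriggered.updatedCov_silent]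
      simp [EventTriggered.kalmanCov]
    · rw [hγ, EventTriggered.updatedMean_sent, EventTriggered.updatedCov_sent]
      simp [EventTriggered.kalmanCov]
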